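/- **Setting.** Let $\beta>0$ and let the system have a $d$-dimensional Hilbert space, with initial Hamiltonian $H_S=\sum_s\mathcal E_s|s\rangle\langle s|$ and final Hamiltonian $H'_S=\sum_{s'}\mathcal E_{s'}|s'\rangle\langle s'|$ (orthonormal eigenbases; $H'_S=H_S$ is allowed). The weight has Hilbert space $L^2(\mathbb R)$, its Hamiltonian $H_W$ is multiplication by the position $x$, and $Q_A$ denotes the spectral projection of the position on a Borel set $A$. A *thermal operation with fluctuating work* from $H_S$ to $H_S'$ consists of a bath with Hamiltonian $H_B$ such that $Z_B=\operatorname{tr}e^{-\beta H_B}<\infty$, in the Gibbs state $\rho_B=e^{-\beta H_B}/Z_B$, and of a unitary $U$ on system, bath and weight that conserves energy, $U(H_S+H_B+H_W)=(H'_S+H_B+H_W)U$, that is, $U\,e^{i\tau(H_S+H_B+H_W)}=e^{i\tau(H'_S+H_B+H_W)}\,U$ for all $\tau\in\mathbb R$, and that commutes with all translations of the weight. Its inverse operation (from $H_S'$ to $H_S$) has the same bath and the unitary $U^\dagger$. A conditional distribution $t(s',w|s)$ is, for each $s$, a probability measure in $(s',w)\in\{1,\dots,d\}\times\mathbb R$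 (Dirac deltas in $w$ are allowed). It *is the map of* a thermal operation, $t(s',w|s)=\langle s'|\Lambda(|s\rangle\langle s|,w)|s'\rangle$, where $w$ is the difference of the positions of the weight measured after and before the operation, if for all $s,s'$, all $\varphi\in L^2(\mathbb R)$ and all Borel sets $A,A'\subseteq\mathbb R$ $$\operatorname{tr}\Big[\big(|s'\rangle\langle s'|\otimes 1\otimes Q_{A'}\big)\,U\big(|s\rangle\langle s|\otimes\rho_B\otimes Q_A|\varphi\rangle\langle\varphi|Q_A\big)U^\dagger\Big]=\int_A|\varphi(x)|^2\Big(\int_{\{w\,:\,x+w\in A'\}}t(s',dw|s)\Big)dx .$$ An infinite bath, which has no normalizable Gibbs state, is understood as a limit of baths that have one: $t$ *comes from a thermal operation with an infinite thermal bath* if there are thermal operations $\Gamma_n$ from $H_S$ to $H_S'$ (the baths may depend on $n$) whose maps $t_n$ converge weakly to $t$ and such that the maps $r_n(s,w|s')$ of the inverse operations also converge weakly to some conditional probability distribution $r(s,w|s')$ (microscopic reversibility in the limit). **Theorem.** Let $t(s',w|s)$ be a conditional distribution, and consider the condition $$\sum_s\int_{\mathbb R} t(s',dw|s)\,e^{\beta(\mathcal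 E_{s'}-\mathcal E_s+w)}=1\qquad\text{for all }s'.\tag{$*$}$$ 1. If $t$ is the map of a thermal operation, then $(*)$ holds. 2. $t$ comes from a thermal operation with an infinite thermal bath if and only if $(*)$ holds. -/

import Mathlib

open MeasureTheory Filter Topology

noncomputable section

namespace FluctuatingWork

/-- The Hilbert space `L²(ℝ)` of the weight, in the position (equivalently, energy)
representation: the weight Hamiltonian `H_W` is multiplication by `x`. -/
abbrev WeightSpace : Type := Lp ℂ 2 (volume : Measure ℝ)

/-- The translation of the weight by `a`, `(T_a φ)(x) = φ (x - a)`; these are the unitaries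
generated by the canonical conjugate of `H_W`. -/
def translate (a : ℝ) (φ : WeightSpace) : WeightSpace :=
  Lp.compMeasurePreserving (fun x : ℝ => x - a) (measurePreserving_sub_right volume a) φ

theorem norm_phase (t x : ℝ) : ‖Complex.exp (t * x * Complex.I)‖ = 1 := by
  rw [← Complex.ofReal_mul, Complex.norm_exp_ofReal_mul_I]

theorem memLp_phase (t : ℝ) (φ : WeightSpace) :
    MemLp (fun x : ℝ => Complex.exp (t * x * Complex.I) * φ x) 2 (volume : Measure ℝ) := by
  refine (Lp.memLp φ).of_le ?_ (ae_of_all _ fun x => ?_)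
  · exact (by fun_prop : Continuous fun x : ℝ =>
      Complex.exp (t * x * Complex.I)).aestronglyMeasurable.mul (Lp.aestronglyMeasurable φ)
  · rw [norm_mul, norm_phase, one_mul]

/-- The evolution `exp (i t H_W)` of the weight: multiplication by `exp (i t x)`. -/
def weightPhase (t : ℝ) (φ : WeightSpace) : WeightSpace := (memLp_phase t φ).toLp _

theorem norm_weightPhase (t : ℝ) (φ : WeightSpace) : ‖weightPhase t φ‖ = ‖φ‖ := by
  rw [weightPhase, Lp.norm_toLp, Lp.norm_def]
  refine congrArg ENNReal.toReal (eLpNorm_congr_norm_ae (ae_of_all _ fun x => ?_))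
  rw [norm_mul, norm_phase, one_mul]

/-- The spectral projection `Q_A = ∫_A |x⟩⟨x| dx` of the position of the weight. -/
def positionProj {A : Set ℝ} (hA : MeasurableSet A) (φ : WeightSpace) : WeightSpace :=
  ((Lp.memLp φ).indicator hA).toLp _

/-- A bath whose Gibbs state at inverse temperature `β` exists, that is, with
`Z_B = tr exp (-β H_B) < ∞`. Then `H_B` has an orthonormal eigenbasis; `ι` labels its elements
(so that the Hilbert space is `ℓ²(ι)`, of finite or infinite dimension) and `ε` lists the
energies with their multiplicities. -/
structure Bath (β : ℝ) where
  ι : Type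
  nonempty : Nonempty ι
  ε : ι → ℝ
  summable : Summable fun b => Real.exp (-β * ε b)

/-- The partition function `Z_B`. -/
def Bath.partition {β : ℝ} (B : Bath β) : ℝ := ∑' b, Real.exp (-β * B.ε b)

/-- The eigenvalues `exp (-β ε_b) / Z_B` of the Gibbs state `ρ_B`. -/
def Bath.gibbs {β : ℝ} (B : Bath β) (b : B.ι) : ℝ := Real.exp (-β * B.ε b) / B.partition

/-- The Hilbert space of system (dimension `d`), bath and weight. A vector is given by its
components `ψ (s, b) ∈ L²(ℝ)` along `|s⟩ ⊗ |b⟩`, where `|s⟩` runs over a fixed orthonormal energy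
eigenbasis of the system and `|b⟩` over that of the bath. -/
abbrev JointSpace (d : ℕ) (ι : Type) : Type := lp (fun _ : Fin d × ι => WeightSpace) 2

/-- Apply a norm-preserving map of `L²(ℝ)` to each component. -/
def componentwise {d : ℕ} {ι : Type} (f : Fin d × ι → WeightSpace → WeightSpace)
    (hf : ∀ i φ, ‖f i φ‖ = ‖φ‖) (ψ : JointSpace d ι) : JointSpace d ι :=
  ⟨fun i => f i (ψ i), memℓp_gen (by
    simpa only [hf] using (memℓp_gen_iff (by norm_num)).1 (lp.memℓp ψ))⟩

/-- The translation of the weight by `a`, on the joint space. -/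
def jointTranslate {d : ℕ} {ι : Type} (a : ℝ) (ψ : JointSpace d ι) : JointSpace d ι :=
  componentwise (fun _ => translate a) (fun _ φ => Lp.norm_compMeasurePreserving φ _) ψ

/-- The evolution `exp (i t (H_S + H_B + H_W))`, where `E` lists the eigenvalues of `H_S` and
`ε` those of `H_B`. -/
def evolve {d : ℕ} {ι : Type} (E : Fin d → ℝ) (ε : ι → ℝ) (t : ℝ) (ψ : JointSpace d ι) :
    JointSpace d ι :=
  componentwise
    (fun i φ => Complex.exp (t * (E i.1 + ε i.2 : ℝ) * Complex.I) • weightPhase t φ)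
    (fun i φ => by rw [norm_smul, norm_phase, one_mul, norm_weightPhase]) ψ

open Classical in
/-- The product vector `|s⟩ ⊗ |b⟩ ⊗ φ`. -/
def productVector {d : ℕ} {ι : Type} (s : Fin d) (b : ι) (φ : WeightSpace) : JointSpace d ι :=
  lp.single 2 (s, b) φ

/-- A thermal operation with fluctuating work, using a bath `B`, that takes the system
Hamiltonian with eigenvalues `E` to the one with eigenvalues `E'`. The coordinates of the system
refer to the eigenbasis `|s⟩` of the initial Hamiltonian in the domain of `U`, and to the eigenbasis
`|s'⟩` of the final one in its codomain. -/
structure ThermalOperation {d : ℕ} (β : ℝ) (E E' : Fin d → ℝ) where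
  B : Bath β
  /-- The joint unitary of system, bath and weight. -/
  U : JointSpace d B.ι ≃ₗᵢ[ℂ] JointSpace d B.ι
  /-- Energy conservation: `U (H_S + H_B + H_W) = (H'_S + H_B + H_W) U`. -/
  energy : ∀ (t : ℝ) (ψ : JointSpace d B.ι), U (evolve E B.ε t ψ) = evolve E' B.ε t (U ψ)
  /-- Independence from the position of the weight: `[U, Δ_W] = 0`. -/
  translation : ∀ (a : ℝ) (ψ : JointSpace d B.ι), U (jointTranslate a ψ) = jointTranslate a (U ψ)

/-- The inverse operation, with the same bath and the unitary `U†`. -/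
def ThermalOperation.inverse {d : ℕ} {β : ℝ} {E E' : Fin d → ℝ} (Γ : ThermalOperation β E E') :
    ThermalOperation β E' E where
  B := Γ.B
  U := Γ.U.symm
  energy t ψ := by
    rw [LinearIsometryEquiv.symm_apply_eq, Γ.energy, LinearIsometryEquiv.apply_symm_apply]
  translation a ψ := by
    rw [LinearIsometryEquiv.symm_apply_eq, Γ.translation, LinearIsometryEquiv.apply_symm_apply]

/-- The probability `tr [(|s'⟩⟨s'| ⊗ 1 ⊗ Q_A') U (|s⟩⟨s| ⊗ ρ_B ⊗ Q_A |φ⟩⟨φ| Q_A) U†]` that the position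
of the weight is found in `A` before the operation and in `A'` after it, and the system in `|s'⟩`,
when the system starts in `|s⟩`, the bath in its Gibbs state and the weight in the state `φ`. -/
def ThermalOperation.outcomeProb {d : ℕ} {β : ℝ} {E E' : Fin d → ℝ} (Γ : ThermalOperation β E E')
    (s s' : Fin d) (φ : WeightSpace) {A : Set ℝ} (hA : MeasurableSet A) (A' : Set ℝ) : ENNReal :=
  ∑' b, ENNReal.ofReal (Γ.B.gibbs b) *
    ∑' b', ∫⁻ x in A', ‖(Γ.U (productVector s b (positionProj hA φ)) (s', b')) x‖ₑ ^ 2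

/-- `t(s',w|s) = ⟨s'|Λ(|s⟩⟨s|,w)|s'⟩`, where `w` is the difference of the positions of the weight
measured after and before the operation `Γ`. As a function of `w`, `t(s',w|s)` is a distribution and
may contain Dirac deltas: `t s` is the joint law of `(s', w)` given `s`. The equation is integrated
over the positions `x ∈ A` and `x + w ∈ A'`, for all Borel sets `A`, `A'` and every initial state `φ`
of the weight. -/
def ThermalOperation.HasWorkMap {d : ℕ} {β : ℝ} {E E' : Fin d → ℝ} (Γ : ThermalOperation β E E')
    (t : Fin d → ProbabilityMeasure (Fin d × ℝ)) : Prop :=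
  ∀ (s s' : Fin d) (φ : WeightSpace) (A A' : Set ℝ) (hA : MeasurableSet A), MeasurableSet A' →
    Γ.outcomeProb s s' φ hA A' =
      ∫⁻ x in A, ‖φ x‖ₑ ^ 2 * (t s : Measure (Fin d × ℝ)) {z | z.1 = s' ∧ x + z.2 ∈ A'}

/-- `t` comes from a thermal operation with an infinite thermal bath. An infinite bath has no
normalizable Gibbs state, and is a limit of baths that have one: `t` is the weak limit of the
maps of thermal operations `Γ n` with such baths. Microscopic reversibility is retained in the
limit: the maps of the inverse operations converge as well, to some conditional probability
distribution `r(s,w|s')`. -/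
def ComesFromThermalOperation {d : ℕ} (β : ℝ) (E E' : Fin d → ℝ)
    (t : Fin d → ProbabilityMeasure (Fin d × ℝ)) : Prop :=
  ∃ (Γ : ℕ → ThermalOperation β E E')
    (tn : ℕ → Fin d → ProbabilityMeasure (Fin d × ℝ))
    (rn : ℕ → Fin d → ProbabilityMeasure (Fin d × ℝ))
    (r : Fin d → ProbabilityMeasure (Fin d × ℝ)),
    (∀ n, (Γ n).HasWorkMap (tn n)) ∧ (∀ n, (Γ n).inverse.HasWorkMap (rn n)) ∧
      Tendsto tn atTop (𝓝 t) ∧ Tendsto rn atTop (𝓝 r)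

/-- The equality `∑_s ∫ dw t(s',w|s) exp (β (E_{s'} - E_s + w)) = 1` for all `s'`. -/
def SecondLawEquality {d : ℕ} (β : ℝ) (E E' : Fin d → ℝ)
    (t : Fin d → ProbabilityMeasure (Fin d × ℝ)) : Prop :=
  ∀ s' : Fin d, ∑ s, ∫⁻ z in {z : Fin d × ℝ | z.1 = s'},
    ENNReal.ofReal (Real.exp (β * (E' s' - E s + z.2))) ∂(t s : Measure (Fin d × ℝ)) = 1

end FluctuatingWork

end

/-! Position phases and translations act irreducibly on `L²(ℝ)` (`exists_eq_smul_of_commute`).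
Energy conservation and translation invariance therefore make every block of `U` between energy
eigenstates a scalar times the translation by the energy difference (`exists_amplitude`). So the map
of a thermal operation is given by transition probabilities at definite values of the work
(`hasWorkMap_iff`). The amplitudes of `U†` are the conjugate transpose, and the Gibbs weights of the
two bath states differ by the factor exp (β (E_{s'} - E_s + w)). The inverse map is thus the forward
one reweighted by this factor and reflected in `w` (`lintegral_workMeasure_inverse`), and the second
law equality is its normalization. The factor is unbounded, so in the limit the relation is tested
with truncations; convergence of the inverse maps to probabilities ensures that nothing is lost
(`lintegral_sector_reverse_of_tendsto`).

For the converse, take a finite bath with levels 0, δ, …, (K - 1) δ and degeneracies close to M exp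
(β δ j), and cut the work axis into cells of width δ. A permutation of eigenstates sends about M exp
(β δ j) q states from (s, j) to (s', j'), where q is the probability under `t s` of s' and cell j -
j'. These counts fit into the sources because `t` is normalized, and into the targets because of the
second law equality (`exists_thermalOperation_grid`). As δ → 0, K δ → ∞ and K / M → 0, the maps and
the inverse maps satisfy liminf bounds on open sets (`exists_thermalOperation_seq`), which for
probability measures amounts to weak convergence. -/

noncomputable section

namespace FluctuatingWork

open ProbabilityTheory

/-! ### Uniqueness of the Fourier transform of integrable functions -/

/-- The positive and negative parts of `r` are densities of finite measures with the same
characteristic function, hence agree almost everywhere; as one of them vanishes at each point, both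
do. -/
theorem ae_eq_zero_of_forall_integral_phase_mul_ofReal_eq_zero {r : ℝ → ℝ} (hr : Integrable r)
    (h : ∀ t : ℝ, ∫ x : ℝ, Complex.exp (t * x * Complex.I) * (r x : ℂ) = 0) : r =ᵐ[volume] 0 := by
  have hfin : ∀ q : ℝ → ℝ, Integrable q →
      IsFiniteMeasure (volume.withDensity fun x => ENNReal.ofReal (q x)) := fun q hq =>
    isFiniteMeasure_withDensity_ofReal hq.2
  have hchar : ∀ q : ℝ → ℝ, Integrable q → ∀ t : ℝ,
      charFun (volume.withDensity fun x => ENNReal.ofReal (q x)) t =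
        ∫ x : ℝ, Complex.exp (t * x * Complex.I) * (max (q x) 0 : ℝ) := by
    intro q hq t
    rw [charFun_apply_real, integral_withDensity_eq_integral_toReal_smul₀
      hq.aestronglyMeasurable.aemeasurable.ennreal_ofReal (ae_of_all _ fun x => by simp)]
    refine integral_congr_ae (ae_of_all _ fun x => ?_)
    simp only [ENNReal.toReal_ofReal', Complex.real_smul]
    ring
  have hint : ∀ q : ℝ → ℝ, Integrable q → ∀ t : ℝ, Integrable fun x : ℝ =>
      Complex.exp (t * x * Complex.I) * (max (q x) 0 : ℝ) := by
    intro q hq t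
    refine (hq.pos_part.ofReal (𝕜 := ℂ)).bdd_mul (c := 1) ?_ (ae_of_all _ fun x => ?_)
    · exact (by fun_prop : Continuous fun x : ℝ =>
        Complex.exp (t * x * Complex.I)).aestronglyMeasurable
    · rw [norm_phase]
  have := hfin r hr
  have hneg : Integrable fun x => -r x := hr.neg
  have := hfin (fun x => -r x) hneg
  have heq : (volume.withDensity fun x => ENNReal.ofReal (r x)) =
      volume.withDensity fun x => ENNReal.ofReal (-r x) := by
    refine Measure.ext_of_charFun (funext fun t => ?_)
    rw [hchar r hr, hchar _ hneg, ← sub_eq_zero, ← integral_sub (hint r hr t) (hint _ hneg t),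
      ← h t]
    refine integral_congr_ae (ae_of_all _ fun x => ?_)
    simp only
    rw [← mul_sub, ← Complex.ofReal_sub]
    congr 2
    rcases le_total (r x) 0 with hx | hx
    · rw [max_eq_right hx, max_eq_left (by linarith)]; ring
    · rw [max_eq_left hx, max_eq_right (by linarith)]; ring
  have := (withDensity_eq_iff hr.aestronglyMeasurable.aemeasurable.ennreal_ofReal
    hr.neg.aestronglyMeasurable.aemeasurable.ennreal_ofReal
    hr.lintegral_lt_top.ne).1 heq
  filter_upwards [this] with x hx
  simp only [Pi.neg_apply] at hx
  rw [Pi.zero_apply]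
  rcases le_total (r x) 0 with h0 | h0
  · rw [ENNReal.ofReal_of_nonpos h0, eq_comm, ENNReal.ofReal_eq_zero] at hx
    exact le_antisymm h0 (by linarith)
  · rw [ENNReal.ofReal_of_nonpos (show -r x ≤ 0 by linarith), ENNReal.ofReal_eq_zero] at hx
    exact le_antisymm hx h0

theorem ae_eq_zero_of_forall_integral_phase_mul_eq_zero {h : ℝ → ℂ} (hh : Integrable h)
    (H : ∀ t : ℝ, ∫ x : ℝ, Complex.exp (t * x * Complex.I) * h x = 0) : h =ᵐ[volume] 0 := by
  have hmul : ∀ (q : ℝ → ℂ), Integrable q → ∀ t : ℝ, Integrable fun x : ℝ =>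
      Complex.exp (t * x * Complex.I) * q x := by
    intro q hq t
    refine hq.bdd_mul (c := 1) ?_ (ae_of_all _ fun x => ?_)
    · exact (by fun_prop : Continuous fun x : ℝ =>
        Complex.exp (t * x * Complex.I)).aestronglyMeasurable
    · rw [norm_phase]
  have hc : Integrable fun x => (starRingEnd ℂ) (h x) :=
    (LinearIsometryEquiv.integrable_comp_iff Complex.conjLIE).2 hh
  have Hc : ∀ t : ℝ, ∫ x : ℝ, Complex.exp (t * x * Complex.I) * (starRingEnd ℂ) (h x) = 0 := by
    intro t
    -- Conjugation flips the sign of the frequency, so the hypothesis at `-t` handles the conjugate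
    -- of `h`.
    have := congrArg (starRingEnd ℂ) (H (-t))
    rw [← integral_conj, map_zero] at this
    rw [← this]
    refine integral_congr_ae (ae_of_all _ fun x => ?_)
    simp [← Complex.exp_conj]
  have hre : (fun x => (h x).re) =ᵐ[volume] 0 := by
    refine ae_eq_zero_of_forall_integral_phase_mul_ofReal_eq_zero hh.re fun t => ?_
    have : ∀ x : ℝ, Complex.exp (t * x * Complex.I) * ((h x).re : ℂ) = (1 / 2 : ℂ) *
        (Complex.exp (t * x * Complex.I) * h x +
          Complex.exp (t * x * Complex.I) * (starRingEnd ℂ) (h x)) := by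
      intro x
      rw [← mul_add, Complex.add_conj]; push_cast; ring
    simp_rw [this]
    rw [integral_const_mul, integral_add (hmul _ hh t) (hmul _ hc t), H, Hc, add_zero, mul_zero]
  have him : (fun x => (h x).im) =ᵐ[volume] 0 := by
    refine ae_eq_zero_of_forall_integral_phase_mul_ofReal_eq_zero hh.im fun t => ?_
    have : ∀ x : ℝ, Complex.exp (t * x * Complex.I) * ((h x).im : ℂ) = (-Complex.I / 2 : ℂ) *
        (Complex.exp (t * x * Complex.I) * h x -
          Complex.exp (t * x * Complex.I) * (starRingEnd ℂ) (h x)) := by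
      intro x
      rw [← mul_sub, Complex.sub_conj]
      push_cast
      linear_combination (Complex.exp (t * x * Complex.I) * ((h x).im : ℂ)) * Complex.I_sq
    simp_rw [this]
    rw [integral_const_mul, integral_sub (hmul _ hh t) (hmul _ hc t), H, Hc, sub_zero, mul_zero]
  filter_upwards [hre, him] with x h1 h2
  exact Complex.ext h1 h2

/-! ### Operators on the weight and irreducibility -/

theorem coeFn_translate (a : ℝ) (φ : WeightSpace) :
    translate a φ =ᵐ[volume] fun x => φ (x - a) :=
  Lp.coeFn_compMeasurePreserving φ (measurePreserving_sub_right volume a)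

theorem coeFn_weightPhase (t : ℝ) (φ : WeightSpace) :
    weightPhase t φ =ᵐ[volume] fun x : ℝ => Complex.exp (t * x * Complex.I) * φ x :=
  MemLp.coeFn_toLp _

theorem coeFn_positionProj {A : Set ℝ} (hA : MeasurableSet A) (φ : WeightSpace) :
    positionProj hA φ =ᵐ[volume] A.indicator φ :=
  MemLp.coeFn_toLp _

theorem ae_sub_right {p : ℝ → Prop} (a : ℝ) (h : ∀ᵐ x, p x) : ∀ᵐ x, p (x - a) :=
  (measurePreserving_sub_right volume a).quasiMeasurePreserving.ae h

theorem translate_translate (a b : ℝ) (φ : WeightSpace) :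
    translate a (translate b φ) = translate (a + b) φ := by
  refine Lp.ext ?_
  filter_upwards [coeFn_translate a (translate b φ), coeFn_translate (a + b) φ,
    ae_sub_right a (coeFn_translate b φ)] with x h1 h2 h3
  rw [h1, h2, h3, sub_sub]

theorem translate_zero (φ : WeightSpace) : translate 0 φ = φ := by
  refine Lp.ext ?_
  filter_upwards [coeFn_translate 0 φ] with x h1
  rw [h1, sub_zero]

theorem translate_smul (a : ℝ) (v : ℂ) (φ : WeightSpace) :
    translate a (v • φ) = v • translate a φ := by
  refine Lp.ext ?_
  filter_upwards [coeFn_translate a (v • φ), coeFn_translate a φ, Lp.coeFn_smul v (translate a φ),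
    ae_sub_right a (Lp.coeFn_smul v φ)] with x h1 h2 h3 h4
  rw [h1, h3, h4, Pi.smul_apply, Pi.smul_apply, h2]

theorem translate_weightPhase (a t : ℝ) (φ : WeightSpace) :
    translate a (weightPhase t φ) =
      Complex.exp (-(t * a) * Complex.I) • weightPhase t (translate a φ) := by
  refine Lp.ext ?_
  filter_upwards [coeFn_translate a (weightPhase t φ), coeFn_translate a φ,
    Lp.coeFn_smul (Complex.exp (-(t * a) * Complex.I)) (weightPhase t (translate a φ)),
    coeFn_weightPhase t (translate a φ), ae_sub_right a (coeFn_weightPhase t φ)]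
    with x h1 h2 h3 h4 h5
  rw [h1, h3, h5, Pi.smul_apply, h4, h2, smul_eq_mul, ← mul_assoc, ← Complex.exp_add]
  congr 2
  push_cast
  ring

/-- Translation of the weight as a linear isometry. -/
def translateₗᵢ (a : ℝ) : WeightSpace →ₗᵢ[ℂ] WeightSpace :=
  Lp.compMeasurePreservingₗᵢ ℂ (fun x : ℝ => x - a) (measurePreserving_sub_right volume a)

/-- The square root of the standard Gaussian density. -/
def gaussianAmplitude (x : ℝ) : ℂ := (Real.sqrt (gaussianPDFReal 0 1 x) : ℝ)

theorem gaussianAmplitude_ne_zero (x : ℝ) : gaussianAmplitude x ≠ 0 := by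
  rw [gaussianAmplitude, Complex.ofReal_ne_zero]
  exact (Real.sqrt_pos.2 (gaussianPDFReal_pos 0 1 x one_ne_zero)).ne'

theorem continuous_gaussianAmplitude : Continuous gaussianAmplitude := by
  unfold gaussianAmplitude gaussianPDFReal
  fun_prop

theorem enorm_gaussianAmplitude_sq (x : ℝ) : ‖gaussianAmplitude x‖ₑ ^ 2 = gaussianPDF 0 1 x := by
  rw [gaussianAmplitude, ← ofReal_norm, Complex.norm_real, Real.norm_eq_abs,
    ← ENNReal.ofReal_pow (abs_nonneg _), sq_abs, Real.sq_sqrt (gaussianPDFReal_nonneg 0 1 x)]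
  rfl

theorem memLp_gaussianAmplitude : MemLp gaussianAmplitude 2 volume := by
  rw [memLp_two_iff_integrable_sq_norm continuous_gaussianAmplitude.aestronglyMeasurable]
  refine (integrable_gaussianPDFReal 0 1).congr (ae_of_all _ fun x => ?_)
  simp only [gaussianAmplitude]
  rw [Complex.norm_real, Real.norm_eq_abs, sq_abs, Real.sq_sqrt (gaussianPDFReal_nonneg 0 1 x)]

/-- The Gaussian state of the weight. -/
def gaussianState : WeightSpace := memLp_gaussianAmplitude.toLp _

theorem coeFn_gaussianState : gaussianState =ᵐ[volume] gaussianAmplitude :=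
  MemLp.coeFn_toLp _

/-- An operator that commutes with all `exp (i t x)` satisfies `(B g) f̄ = g (B† f)̄`. -/
theorem mul_conj_eq_of_commute_weightPhase (B : WeightSpace →L[ℂ] WeightSpace)
    (hB : ∀ t φ, B (weightPhase t φ) = weightPhase t (B φ)) (f g : WeightSpace) :
    ∀ᵐ x, B g x * (starRingEnd ℂ) (f x) = g x * (starRingEnd ℂ) (B.adjoint f x) := by
  have h1 : Integrable fun x => B g x * (starRingEnd ℂ) (f x) := L2.integrable_inner f (B g)
  have h2 : Integrable fun x => g x * (starRingEnd ℂ) (B.adjoint f x) :=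
    L2.integrable_inner (B.adjoint f) g
  have hphase : ∀ (t : ℝ) (q : ℝ → ℂ), Integrable q → Integrable fun x : ℝ =>
      Complex.exp (t * x * Complex.I) * q x := by
    intro t q hq
    refine hq.bdd_mul (c := 1) ?_ (ae_of_all _ fun x => by rw [norm_phase])
    exact (by fun_prop : Continuous fun x : ℝ =>
      Complex.exp (t * x * Complex.I)).aestronglyMeasurable
  have hinner : ∀ (t : ℝ) (u w : WeightSpace), inner ℂ u (weightPhase t w) =
      ∫ x : ℝ, Complex.exp (t * x * Complex.I) * (w x * (starRingEnd ℂ) (u x)) := by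
    intro t u w
    rw [L2.inner_def]
    refine integral_congr_ae ?_
    filter_upwards [coeFn_weightPhase t w] with x hx
    rw [hx, RCLike.inner_apply, mul_assoc]
  -- The Fourier transforms of the two sides are ⟨f, e^{itx} B g⟩ and ⟨B† f, e^{itx} g⟩, equal by
  -- commutation.
  have := ae_eq_zero_of_forall_integral_phase_mul_eq_zero (h1.sub h2) (fun t => by
    simp only [Pi.sub_apply, mul_sub]
    rw [integral_sub (hphase t _ h1) (hphase t _ h2), ← hinner t f (B g), ← hinner t _ g,
      ContinuousLinearMap.adjoint_inner_left, hB, sub_self])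
  filter_upwards [this] with x hx
  exact sub_eq_zero.1 hx

/-- The position and momentum operators act irreducibly on `L²(ℝ)`. -/
theorem exists_eq_smul_of_commute (B : WeightSpace →L[ℂ] WeightSpace)
    (hphase : ∀ t φ, B (weightPhase t φ) = weightPhase t (B φ))
    (htrans : ∀ a φ, B (translate a φ) = translate a (B φ)) : ∃ v : ℂ, ∀ φ, B φ = v • φ := by
  set F : ℝ → ℂ := ⇑(B gaussianState)
  have hFm : Measurable F := (Lp.stronglyMeasurable _).measurable
  have hreal : ∀ x, (starRingEnd ℂ) (gaussianAmplitude x) = gaussianAmplitude x := fun x =>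
    Complex.conj_ofReal _
  have hadj : ∀ᵐ x, (starRingEnd ℂ) (B.adjoint gaussianState x) = F x := by
    filter_upwards [mul_conj_eq_of_commute_weightPhase B hphase gaussianState gaussianState,
      coeFn_gaussianState] with x h1 h2
    rw [h2, hreal, mul_comm] at h1
    exact (mul_left_cancel₀ (gaussianAmplitude_ne_zero x) h1).symm
  -- `B` is multiplication by `F / gaussianAmplitude`, meaningful because the Gaussian never
  -- vanishes. It remains to see that this quotient is constant.
  have hmul : ∀ g : WeightSpace, ∀ᵐ x, B g x * gaussianAmplitude x = g x * F x := by
    intro g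
    filter_upwards [mul_conj_eq_of_commute_weightPhase B hphase gaussianState g,
      coeFn_gaussianState, hadj] with x h1 h2 h3
    rwa [h2, hreal, h3] at h1
  have hshift : ∀ a : ℝ, ∀ᵐ x, F (x - a) * gaussianAmplitude x = gaussianAmplitude (x - a) * F x := by
    intro a
    filter_upwards [hmul (translate a gaussianState), coeFn_translate a gaussianState,
      coeFn_translate a (B gaussianState), ae_sub_right a coeFn_gaussianState] with x h1 h2 h3 h4
    rw [h2, htrans, h3, h4] at h1
    exact h1
  have hgm : Measurable gaussianAmplitude := continuous_gaussianAmplitude.measurable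
  have hset : MeasurableSet {p : ℝ × ℝ | F (p.2 - p.1) * gaussianAmplitude p.2 =
      gaussianAmplitude (p.2 - p.1) * F p.2} :=
    measurableSet_eq_fun (by fun_prop) (by fun_prop)
  -- The null set in `hshift` depends on the shift; Fubini exchanges the quantifiers so that one
  -- base point `x₀` serves almost all shifts.
  have hswap : ∀ᵐ x, ∀ᵐ a, F (x - a) * gaussianAmplitude x = gaussianAmplitude (x - a) * F x :=
    (Measure.ae_ae_comm hset).1 (ae_of_all _ hshift)
  obtain ⟨x₀, hx₀⟩ := hswap.exists
  have hx₁ : ∀ᵐ y, F y * gaussianAmplitude x₀ = gaussianAmplitude y * F x₀ := by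
    have := (Measure.measurePreserving_sub_left volume x₀).quasiMeasurePreserving.ae hx₀
    filter_upwards [this] with y hy
    simpa using hy
  refine ⟨F x₀ / gaussianAmplitude x₀, fun g => Lp.ext ?_⟩
  filter_upwards [hmul g, hx₁, Lp.coeFn_smul (F x₀ / gaussianAmplitude x₀) g] with x h1 h2 h3
  rw [h3, Pi.smul_apply, smul_eq_mul]
  refine mul_right_cancel₀ (gaussianAmplitude_ne_zero x) ?_
  refine mul_right_cancel₀ (gaussianAmplitude_ne_zero x₀) ?_
  rw [h1, mul_assoc, h2]
  field_simp [gaussianAmplitude_ne_zero x₀]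

/-! ### Product vectors in the joint space -/

section Joint

variable {d : ℕ} {ι : Type}

open Classical in
theorem productVector_apply (i : Fin d × ι) (φ : WeightSpace) (j : Fin d × ι) :
    productVector i.1 i.2 φ j = if j = i then φ else 0 := by
  rw [productVector, lp.single_apply]
  split_ifs with h
  · subst h; rw [Pi.single_eq_same]
  · rw [Pi.single_eq_of_ne h]

theorem productVector_apply_self (i : Fin d × ι) (φ : WeightSpace) :
    productVector i.1 i.2 φ i = φ := by
  rw [productVector_apply, if_pos rfl]

theorem norm_productVector (i : Fin d × ι) (φ : WeightSpace) :
    ‖productVector i.1 i.2 φ‖ = ‖φ‖ := by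
  classical
  exact lp.norm_single (by norm_num) _ _

open Classical in
/-- The linear map `φ ↦ |s⟩ ⊗ |b⟩ ⊗ φ`. -/
def productVectorL (i : Fin d × ι) : WeightSpace →L[ℂ] JointSpace d ι :=
  lp.singleContinuousLinearMap ℂ (fun _ : Fin d × ι => WeightSpace) 2 (i.1, i.2)

theorem inner_productVector_left (i : Fin d × ι) (φ : WeightSpace) (ψ : JointSpace d ι) :
    inner ℂ (productVector i.1 i.2 φ) ψ = inner ℂ φ (ψ i) := by
  classical
  exact lp.inner_single_left (𝕜 := ℂ) i φ ψ

theorem inner_productVector_right (i : Fin d × ι) (φ : WeightSpace) (ψ : JointSpace d ι) :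
    inner ℂ ψ (productVector i.1 i.2 φ) = inner ℂ (ψ i) φ := by
  classical
  exact lp.inner_single_right (𝕜 := ℂ) i φ ψ

theorem componentwise_productVector (f : Fin d × ι → WeightSpace → WeightSpace)
    (hf : ∀ i φ, ‖f i φ‖ = ‖φ‖) (i : Fin d × ι) (φ : WeightSpace) :
    componentwise f hf (productVector i.1 i.2 φ) = productVector i.1 i.2 (f i φ) := by
  classical
  refine lp.ext (funext fun j => ?_)
  change f j (productVector i.1 i.2 φ j) = productVector i.1 i.2 (f i φ) j
  rw [productVector_apply, productVector_apply]
  split_ifs with h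
  · rw [h]
  · rw [← norm_eq_zero, hf, norm_zero]

theorem evolve_productVector (E : Fin d → ℝ) (ε : ι → ℝ) (t : ℝ) (i : Fin d × ι)
    (φ : WeightSpace) : evolve E ε t (productVector i.1 i.2 φ) = productVector i.1 i.2
      (Complex.exp (t * (E i.1 + ε i.2 : ℝ) * Complex.I) • weightPhase t φ) :=
  componentwise_productVector _ _ i φ

theorem jointTranslate_productVector (a : ℝ) (i : Fin d × ι) (φ : WeightSpace) :
    jointTranslate a (productVector i.1 i.2 φ) = productVector i.1 i.2 (translate a φ) :=
  componentwise_productVector _ _ i φ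

theorem evolve_apply (E : Fin d → ℝ) (ε : ι → ℝ) (t : ℝ) (ψ : JointSpace d ι) (i : Fin d × ι) :
    evolve E ε t ψ i = Complex.exp (t * (E i.1 + ε i.2 : ℝ) * Complex.I) • weightPhase t (ψ i) :=
  rfl

theorem jointTranslate_apply (a : ℝ) (ψ : JointSpace d ι) (i : Fin d × ι) :
    jointTranslate a ψ i = translate a (ψ i) := rfl

end Joint

/-! ### The amplitudes of a thermal operation -/

namespace ThermalOperation

variable {d : ℕ} {β : ℝ} {E E' : Fin d → ℝ}

/-- The energy received by the weight in the transition from `|s⟩ ⊗ |b⟩` to `|s'⟩ ⊗ |b'⟩`. -/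
def work (Γ : ThermalOperation β E E') (i i' : Fin d × Γ.B.ι) : ℝ :=
  E i.1 + Γ.B.ε i.2 - E' i'.1 - Γ.B.ε i'.2

/-- Energy conservation and translation invariance force the unitary to act on the weight by
translations alone. -/
theorem exists_amplitude (Γ : ThermalOperation β E E') (i i' : Fin d × Γ.B.ι) :
    ∃ v : ℂ, ∀ φ, Γ.U (productVector i.1 i.2 φ) i' = v • translate (Γ.work i i') φ := by
  set c := Γ.work i i' with hc
  let C : WeightSpace →L[ℂ] WeightSpace := (lp.evalCLM ℂ (fun _ : Fin d × Γ.B.ι => WeightSpace)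
    2 i').comp (Γ.U.toContinuousLinearEquiv.toContinuousLinearMap.comp (productVectorL i))
  have hC : ∀ φ, C φ = Γ.U (productVector i.1 i.2 φ) i' := fun φ => rfl
  have hphase : ∀ t φ, C (weightPhase t φ) =
      Complex.exp (-(t * c) * Complex.I) • weightPhase t (C φ) := by
    intro t φ
    have h := congrArg (fun ψ => ψ i') (Γ.energy t (productVector i.1 i.2 φ))
    simp only at h
    rw [evolve_productVector, evolve_apply, ← hC, ← hC, map_smul] at h
    have h' := congrArg
      (fun w => Complex.exp (-(t * (E i.1 + Γ.B.ε i.2 : ℝ) * Complex.I)) • w) h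
    simp only [smul_smul, ← Complex.exp_add] at h'
    rw [neg_add_cancel, Complex.exp_zero, one_smul] at h'
    rw [h']
    congr 2
    rw [hc, work]
    push_cast
    ring
  have htrans : ∀ a φ, C (translate a φ) = translate a (C φ) := by
    intro a φ
    have h := congrArg (fun ψ => ψ i') (Γ.translation a (productVector i.1 i.2 φ))
    simp only at h
    rwa [jointTranslate_productVector, jointTranslate_apply, ← hC, ← hC] at h
  -- The block `C` commutes with phases up to the factor exp (-itc), exactly as the translation by
  -- `c` does. Undoing this translation leaves an operator that commutes with both families.
  obtain ⟨v, hv⟩ := exists_eq_smul_of_commute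
    ((translateₗᵢ (-c)).toContinuousLinearMap.comp C)
    (fun t φ => by
      change translate (-c) (C (weightPhase t φ)) = weightPhase t (translate (-c) (C φ))
      rw [hphase, translate_smul, translate_weightPhase, smul_smul, ← Complex.exp_add]
      convert one_smul ℂ _ using 2
      rw [← Complex.exp_zero]
      congr 1
      push_cast
      ring)
    (fun a φ => by
      change translate (-c) (C (translate a φ)) = translate a (translate (-c) (C φ))
      rw [htrans, translate_translate, translate_translate, add_comm])
  refine ⟨v, fun φ => ?_⟩
  have h : translate (-c) (C φ) = v • φ := hv φ
  rw [← hC, ← translate_smul, ← h, translate_translate, add_neg_cancel, translate_zero]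

/-- The matrix elements of the unitary on system and bath that determines the operation. -/
def amplitude (Γ : ThermalOperation β E E') (i i' : Fin d × Γ.B.ι) : ℂ :=
  (Γ.exists_amplitude i i').choose

theorem U_productVector (Γ : ThermalOperation β E E') (i i' : Fin d × Γ.B.ι) (φ : WeightSpace) :
    Γ.U (productVector i.1 i.2 φ) i' = Γ.amplitude i i' • translate (Γ.work i i') φ :=
  (Γ.exists_amplitude i i').choose_spec φ

theorem norm_translate (a : ℝ) (φ : WeightSpace) : ‖translate a φ‖ = ‖φ‖ :=
  Lp.norm_compMeasurePreserving φ _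

theorem gaussianState_ne_zero : gaussianState ≠ 0 := by
  intro h
  have h1 := coeFn_gaussianState
  rw [h] at h1
  obtain ⟨x, hx, hx'⟩ := (h1.and (Lp.coeFn_zero ℂ 2 (volume : Measure ℝ))).exists
  exact gaussianAmplitude_ne_zero x (by rw [← hx, hx', Pi.zero_apply])

theorem work_inverse (Γ : ThermalOperation β E E') (i i' : Fin d × Γ.B.ι) :
    Γ.inverse.work i' i = -Γ.work i i' := by
  change E' i'.1 + Γ.B.ε i'.2 - E i.1 - Γ.B.ε i.2 = _
  rw [work]; ring

/-- The same matrix element of `U` is evaluated by letting `U` act on the right or `U†` on the left;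
the displacements cancel because the reverse work is opposite. -/
theorem amplitude_eq_conj (Γ : ThermalOperation β E E') (i i' : Fin d × Γ.B.ι) :
    Γ.amplitude i i' = (starRingEnd ℂ) (Γ.inverse.amplitude i' i) := by
  set g := gaussianState
  set c := Γ.work i i' with hc
  have h1 : inner ℂ (productVector i'.1 i'.2 (translate c g)) (Γ.U (productVector i.1 i.2 g)) =
      Γ.amplitude i i' * ((‖g‖ ^ 2 : ℝ) : ℂ) := by
    rw [inner_productVector_left, U_productVector, inner_smul_right, inner_self_eq_norm_sq_to_K,
      norm_translate]
    push_cast; rfl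
  have h2 : inner ℂ (productVector i'.1 i'.2 (translate c g)) (Γ.U (productVector i.1 i.2 g)) =
      (starRingEnd ℂ) (Γ.inverse.amplitude i' i) * ((‖g‖ ^ 2 : ℝ) : ℂ) := by
    have : Γ.inverse.U (productVector i'.1 i'.2 (translate c g)) i =
        Γ.inverse.amplitude i' i • g := by
      rw [U_productVector Γ.inverse i' i, work_inverse, translate_translate, ← hc, neg_add_cancel,
        translate_zero]
    rw [← LinearIsometryEquiv.inner_map_map Γ.U.symm, LinearIsometryEquiv.symm_apply_apply,
      inner_productVector_right]
    change inner ℂ (Γ.inverse.U (productVector i'.1 i'.2 (translate c g)) i) g = _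
    rw [this, inner_smul_left, inner_self_eq_norm_sq_to_K]
    push_cast; rfl
  refine mul_right_cancel₀ (b := ((‖g‖ ^ 2 : ℝ) : ℂ)) ?_ (h1.symm.trans h2)
  rw [Complex.ofReal_ne_zero]
  exact pow_ne_zero 2 (norm_ne_zero_iff.2 gaussianState_ne_zero)

theorem enorm_amplitude_inverse (Γ : ThermalOperation β E E') (i i' : Fin d × Γ.B.ι) :
    ‖Γ.inverse.amplitude i' i‖ₑ = ‖Γ.amplitude i i'‖ₑ := by
  rw [amplitude_eq_conj, ← ofReal_norm, ← ofReal_norm, RCLike.norm_conj]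

/-- Isometry of `U` on a product vector: every block rescales the norm of the weight state by the
modulus of its amplitude. -/
theorem tsum_enorm_amplitude_sq (Γ : ThermalOperation β E E') (i : Fin d × Γ.B.ι) :
    ∑' i', ‖Γ.amplitude i i'‖ₑ ^ 2 = 1 := by
  have h := lp.hasSum_norm (p := 2) (by norm_num) (Γ.U (productVector i.1 i.2 gaussianState))
  have hg : ‖gaussianState‖ ^ 2 ≠ 0 := pow_ne_zero 2 (norm_ne_zero_iff.2 gaussianState_ne_zero)
  simp only [ENNReal.toReal_ofNat, Real.rpow_ofNat] at h
  simp only [U_productVector, norm_smul, norm_translate, mul_pow,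
    LinearIsometryEquiv.norm_map, norm_productVector] at h
  have h' := h.div_const (‖gaussianState‖ ^ 2)
  simp only [mul_div_cancel_right₀ _ hg, div_self hg] at h'
  have h2 : ∀ i', ‖Γ.amplitude i i'‖ₑ ^ 2 = ENNReal.ofReal (‖Γ.amplitude i i'‖ ^ 2) := fun i' => by
    rw [ENNReal.ofReal_pow (norm_nonneg _), ofReal_norm]
  simp_rw [h2]
  rw [← ENNReal.ofReal_tsum_of_nonneg (fun _ => by positivity) h'.summable, h'.tsum_eq,
    ENNReal.ofReal_one]

end ThermalOperation

/-! ### Joint laws of final level and work, split by level -/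

section Sector

variable {d : ℕ}

/-- The distribution of `w` in the joint law of `(s', w)`, restricted to a given value of `s'`. -/
def sector (μ : Measure (Fin d × ℝ)) (s' : Fin d) : Measure ℝ :=
  (μ.restrict {z | z.1 = s'}).map Prod.snd

theorem measurableSet_fst_eq (s' : Fin d) : MeasurableSet {z : Fin d × ℝ | z.1 = s'} :=
  measurable_fst (measurableSet_singleton s')

theorem lintegral_sector (μ : Measure (Fin d × ℝ)) (s' : Fin d) {f : ℝ → ENNReal}
    (hf : Measurable f) : ∫⁻ w, f w ∂(sector μ s') = ∫⁻ z in {z | z.1 = s'}, f z.2 ∂μ :=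
  lintegral_map hf measurable_snd

theorem sector_apply (μ : Measure (Fin d × ℝ)) (s' : Fin d) {S : Set ℝ} (hS : MeasurableSet S) :
    sector μ s' S = μ {z | z.1 = s' ∧ z.2 ∈ S} := by
  rw [sector, Measure.map_apply measurable_snd hS, Measure.restrict_apply (measurable_snd hS),
    Set.inter_comm]
  rfl

instance (μ : Measure (Fin d × ℝ)) [IsFiniteMeasure μ] (s' : Fin d) :
    IsFiniteMeasure (sector μ s') := by
  unfold sector; infer_instance

theorem measurable_prodMk_sector (s' : Fin d) : Measurable fun w : ℝ => (s', w) := by fun_prop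

theorem measure_eq_sum_sector (μ : Measure (Fin d × ℝ)) {S : Set (Fin d × ℝ)}
    (hS : MeasurableSet S) : μ S = ∑ s', sector μ s' {w | (s', w) ∈ S} := by
  have h : S = ⋃ s' ∈ (Finset.univ : Finset (Fin d)), {z | z.1 = s' ∧ z.2 ∈ {w | (s', w) ∈ S}} := by
    ext ⟨a, w⟩
    simp
  conv_lhs => rw [h]
  rw [measure_biUnion_finset]
  · exact Finset.sum_congr rfl fun s' _ =>
      (sector_apply μ s' (measurable_prodMk_sector s' hS)).symm
  · intro a _ b _ hab
    refine Set.disjoint_left.2 fun z hz hz' => hab ?_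
    rw [← hz.1, ← hz'.1]
  · exact fun s' _ => (measurableSet_fst_eq s').inter
      (measurable_snd (measurable_prodMk_sector s' hS))

theorem sum_sector_univ (μ : Measure (Fin d × ℝ)) : ∑ s', sector μ s' Set.univ = μ Set.univ :=
  (measure_eq_sum_sector μ MeasurableSet.univ).symm

/-- The joint law of `(s', w)` with prescribed sectors. -/
def assemble (m : Fin d → Measure ℝ) : Measure (Fin d × ℝ) :=
  Measure.sum fun s' => (m s').map fun w => (s', w)

theorem assemble_apply (m : Fin d → Measure ℝ) {S : Set (Fin d × ℝ)} (hS : MeasurableSet S) :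
    assemble m S = ∑ s', m s' {w | (s', w) ∈ S} := by
  rw [assemble, Measure.sum_apply _ hS, tsum_fintype]
  exact Finset.sum_congr rfl fun s' _ => Measure.map_apply (measurable_prodMk_sector s') hS

theorem sector_assemble (m : Fin d → Measure ℝ) (s' : Fin d) : sector (assemble m) s' = m s' := by
  refine Measure.ext fun S hS => ?_
  have hS' : MeasurableSet {z : Fin d × ℝ | z.1 = s' ∧ z.2 ∈ S} :=
    (measurableSet_fst_eq s').inter (measurable_snd hS)
  rw [sector_apply _ _ hS, assemble_apply _ hS', Finset.sum_eq_single s']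
  · simp
  · intro b _ hb
    simp [hb]
  · simp

theorem isProbabilityMeasure_assemble {m : Fin d → Measure ℝ} (h : ∑ s', m s' Set.univ = 1) :
    IsProbabilityMeasure (assemble m) :=
  ⟨by rw [assemble_apply _ MeasurableSet.univ]; simpa using h⟩

theorem secondLawEquality_iff (β : ℝ) (E E' : Fin d → ℝ)
    (t : Fin d → ProbabilityMeasure (Fin d × ℝ)) : SecondLawEquality β E E' t ↔
      ∀ s', ∑ s, ∫⁻ w, ENNReal.ofReal (Real.exp (β * (E' s' - E s + w)))
        ∂(sector (t s : Measure (Fin d × ℝ)) s') = 1 := by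
  refine forall_congr' fun s' => ?_
  have h : ∀ s, ∫⁻ w, ENNReal.ofReal (Real.exp (β * (E' s' - E s + w)))
        ∂(sector (t s : Measure (Fin d × ℝ)) s') = _ := fun s =>
    lintegral_sector (t s : Measure (Fin d × ℝ)) s'
      (f := fun w => ENNReal.ofReal (Real.exp (β * (E' s' - E s + w)))) (by fun_prop)
  simp_rw [h]

end Sector

/-! ### Work distribution and microscopic reversibility -/

/-- A summable family of positive numbers has a countable index set. This allows sums over the bath
and integrals to be exchanged. -/
theorem Bath.countable {β : ℝ} (B : Bath β) : Countable B.ι := by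
  have h := B.summable.countable_support
  rwa [show (Function.support fun b => Real.exp (-β * B.ε b)) = Set.univ from
    Set.eq_univ_of_forall fun b => (Real.exp_pos _).ne', Set.countable_univ_iff] at h

theorem Bath.partition_pos {β : ℝ} (B : Bath β) : 0 < B.partition := by
  obtain ⟨b⟩ := B.nonempty
  exact B.summable.tsum_pos (fun _ => (Real.exp_pos _).le) b (Real.exp_pos _)

theorem Bath.tsum_gibbs {β : ℝ} (B : Bath β) : ∑' b, ENNReal.ofReal (B.gibbs b) = 1 := by
  have h := B.summable.hasSum.div_const B.partition
  rw [show (∑' b, Real.exp (-β * B.ε b)) / B.partition = 1 from div_self B.partition_pos.ne'] at h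
  have hnn : ∀ b, 0 ≤ B.gibbs b := fun b => div_nonneg (Real.exp_pos _).le B.partition_pos.le
  rw [← ENNReal.ofReal_tsum_of_nonneg hnn h.summable, show ∑' b, B.gibbs b = 1 from h.tsum_eq,
    ENNReal.ofReal_one]

theorem lintegral_enorm_translate_positionProj (c : ℝ) (v : ℂ) (φ : WeightSpace) {A A' : Set ℝ}
    (hA : MeasurableSet A) (hA' : MeasurableSet A') :
    ∫⁻ x in A', ‖(v • translate c (positionProj hA φ)) x‖ₑ ^ 2 =
      ∫⁻ x in A, ‖φ x‖ₑ ^ 2 * (‖v‖ₑ ^ 2 * A'.indicator 1 (x + c)) := by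
  have hφ : AEMeasurable (fun x => ‖φ x‖ₑ ^ 2) volume :=
    (Lp.aestronglyMeasurable φ).enorm.pow_const 2
  rw [← lintegral_indicator hA', ← lintegral_indicator hA,
    ← lintegral_add_right_eq_self _ c]
  refine lintegral_congr_ae ?_
  have h1 := (measurePreserving_add_right volume c).quasiMeasurePreserving.ae
    (Lp.coeFn_smul v (translate c (positionProj hA φ)))
  have h2 := (measurePreserving_add_right volume c).quasiMeasurePreserving.ae
    (coeFn_translate c (positionProj hA φ))
  filter_upwards [h1, h2, coeFn_positionProj hA φ] with x h1 h2 h3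
  rw [add_sub_cancel_right] at h2
  classical
  simp only [Set.indicator_apply]
  rw [h1, Pi.smul_apply, h2, h3, enorm_smul, mul_pow, Set.indicator_apply]
  split_ifs <;> simp [mul_comm]

namespace ThermalOperation

variable {d : ℕ} {β : ℝ} {E E' : Fin d → ℝ}

/-- The distribution of the work `w` and of the final level `s'` given the initial level `s`. -/
def workMeasure (Γ : ThermalOperation β E E') (s s' : Fin d) : Measure ℝ :=
  Measure.sum fun b => ENNReal.ofReal (Γ.B.gibbs b) • Measure.sum fun b' =>
    (‖Γ.amplitude (s, b) (s', b')‖ₑ ^ 2) • Measure.dirac (Γ.work (s, b) (s', b'))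

theorem lintegral_workMeasure (Γ : ThermalOperation β E E') (s s' : Fin d) (f : ℝ → ENNReal) :
    ∫⁻ w, f w ∂(Γ.workMeasure s s') = ∑' b, ENNReal.ofReal (Γ.B.gibbs b) *
      ∑' b', ‖Γ.amplitude (s, b) (s', b')‖ₑ ^ 2 * f (Γ.work (s, b) (s', b')) := by
  simp only [workMeasure, lintegral_sum_measure, lintegral_smul_measure, lintegral_dirac,
    smul_eq_mul]

theorem sum_workMeasure_univ (Γ : ThermalOperation β E E') (s : Fin d) :
    ∑ s', Γ.workMeasure s s' Set.univ = 1 := by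
  have h : ∀ s', Γ.workMeasure s s' Set.univ = ∑' b, ENNReal.ofReal (Γ.B.gibbs b) *
      ∑' b', ‖Γ.amplitude (s, b) (s', b')‖ₑ ^ 2 := fun s' => by
    rw [← lintegral_one, lintegral_workMeasure]
    simp only [mul_one]
  simp_rw [h]
  rw [← Summable.tsum_finsetSum fun _ _ => ENNReal.summable, ← Γ.B.tsum_gibbs]
  refine tsum_congr fun b => ?_
  rw [← Finset.mul_sum, ← tsum_fintype (L := .unconditional _), ← ENNReal.tsum_prod,
    Γ.tsum_enorm_amplitude_sq (s, b), mul_one]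

theorem outcomeProb_eq (Γ : ThermalOperation β E E') (s s' : Fin d) (φ : WeightSpace)
    {A A' : Set ℝ} (hA : MeasurableSet A) (hA' : MeasurableSet A') :
    Γ.outcomeProb s s' φ hA A' =
      ∫⁻ x in A, ‖φ x‖ₑ ^ 2 * Γ.workMeasure s s' {w | x + w ∈ A'} := by
  have := Γ.B.countable
  have hφ : AEMeasurable (fun x => ‖φ x‖ₑ ^ 2) (volume.restrict A) :=
    ((Lp.aestronglyMeasurable φ).enorm.pow_const 2).restrict
  have hind : ∀ c : ℝ, Measurable fun x : ℝ => A'.indicator (1 : ℝ → ENNReal) (x + c) := fun c =>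
    (measurable_one.indicator hA').comp (measurable_add_const c)
  have hm : ∀ x, Γ.workMeasure s s' {w | x + w ∈ A'} = ∑' b, ENNReal.ofReal (Γ.B.gibbs b) *
      ∑' b', ‖Γ.amplitude (s, b) (s', b')‖ₑ ^ 2 *
        A'.indicator 1 (x + Γ.work (s, b) (s', b')) := fun x => by
    have hx : MeasurableSet {w | x + w ∈ A'} := measurable_const_add x hA'
    rw [← lintegral_indicator_one hx, lintegral_workMeasure]
    rfl
  simp_rw [hm, ← ENNReal.tsum_mul_left]
  rw [lintegral_tsum fun b => by fun_prop]
  refine tsum_congr fun b => ?_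
  rw [lintegral_tsum fun b' => by fun_prop, ← ENNReal.tsum_mul_left]
  refine tsum_congr fun b' => ?_
  have hU := Γ.U_productVector (s, b) (s', b') (positionProj hA φ)
  simp only at hU
  rw [hU, lintegral_enorm_translate_positionProj _ _ _ hA hA', ← lintegral_const_mul' _ _ (by simp)]
  refine lintegral_congr fun x => ?_
  ring

/-- With the weight in the Gaussian state, the final position is the initial one plus an independent
work value, hence a convolution. -/
theorem lintegral_gaussian_mul (m : Measure ℝ) [SFinite m] {A' : Set ℝ} (hA' : MeasurableSet A') :
    ∫⁻ x, ‖gaussianState x‖ₑ ^ 2 * m {w | x + w ∈ A'} = (gaussianReal 0 1 ∗ m) A' := by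
  rw [Measure.conv, Measure.map_apply measurable_add hA', Measure.prod_apply (measurable_add hA'),
    gaussianReal_of_var_ne_zero _ one_ne_zero,
    lintegral_withDensity_eq_lintegral_mul _ (measurable_gaussianPDF 0 1)
      (measurable_measure_prodMk_left (measurable_add hA'))]
  refine lintegral_congr_ae ?_
  filter_upwards [coeFn_gaussianState] with x hx
  rw [hx, enorm_gaussianAmplitude_sq]
  rfl

/-- Deconvolution is possible because the Gaussian characteristic function has no zeros. A single
weight state thus determines the work distribution. -/
theorem eq_of_gaussian_conv_eq {m m' : Measure ℝ} [IsFiniteMeasure m] [IsFiniteMeasure m']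
    (h : gaussianReal 0 1 ∗ m = gaussianReal 0 1 ∗ m') : m = m' := by
  refine Measure.ext_of_charFun (funext fun t => ?_)
  have h1 := congrArg (fun μ => charFun μ t) h
  simp only [charFun_conv] at h1
  refine mul_left_cancel₀ ?_ h1
  rw [charFun_gaussianReal]
  exact Complex.exp_ne_zero _

theorem isFiniteMeasure_workMeasure (Γ : ThermalOperation β E E') (s s' : Fin d) :
    IsFiniteMeasure (Γ.workMeasure s s') :=
  ⟨lt_of_le_of_lt (Finset.single_le_sum (f := fun s' => Γ.workMeasure s s' Set.univ)
    (fun _ _ => zero_le) (Finset.mem_univ s'))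
    (by rw [Γ.sum_workMeasure_univ s]; exact ENNReal.one_lt_top)⟩

/-- The map of a thermal operation is determined by its distribution of work. -/
theorem hasWorkMap_iff (Γ : ThermalOperation β E E')
    (t : Fin d → ProbabilityMeasure (Fin d × ℝ)) : Γ.HasWorkMap t ↔
      ∀ s s', sector (t s : Measure (Fin d × ℝ)) s' = Γ.workMeasure s s' := by
  have hsec : ∀ s s' (x : ℝ) (A' : Set ℝ), MeasurableSet A' →
      (t s : Measure (Fin d × ℝ)) {z | z.1 = s' ∧ x + z.2 ∈ A'} =
        sector (t s : Measure (Fin d × ℝ)) s' {w | x + w ∈ A'} := fun s s' x A' hA' =>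
    (sector_apply _ s' (measurable_const_add x hA')).symm
  constructor
  · intro h s s'
    have := Γ.isFiniteMeasure_workMeasure s s'
    refine eq_of_gaussian_conv_eq (Measure.ext fun A' hA' => ?_)
    have h1 := h s s' gaussianState Set.univ A' MeasurableSet.univ hA'
    rw [Γ.outcomeProb_eq s s' _ _ hA', setLIntegral_univ, setLIntegral_univ,
      lintegral_gaussian_mul _ hA'] at h1
    rw [h1, ← lintegral_gaussian_mul _ hA']
    exact lintegral_congr fun x => by rw [hsec s s' x A' hA']
  · intro h s s' φ A A' hA hA'
    rw [Γ.outcomeProb_eq s s' φ hA hA', ← h s s']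
    exact lintegral_congr fun x => by rw [hsec s s' x A' hA']

theorem exists_hasWorkMap (Γ : ThermalOperation β E E') :
    ∃ t : Fin d → ProbabilityMeasure (Fin d × ℝ), Γ.HasWorkMap t :=
  ⟨fun s => ⟨assemble (Γ.workMeasure s), isProbabilityMeasure_assemble (Γ.sum_workMeasure_univ s)⟩,
    (Γ.hasWorkMap_iff _).2 fun _ s' => sector_assemble _ s'⟩

/-- Microscopic reversibility. -/
theorem lintegral_workMeasure_inverse (Γ : ThermalOperation β E E') (s s' : Fin d)
    (f : ℝ → ENNReal) : ∫⁻ w, f w ∂(Γ.inverse.workMeasure s' s) =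
      ∫⁻ w, ENNReal.ofReal (Real.exp (β * (E' s' - E s + w))) * f (-w)
        ∂(Γ.workMeasure s s') := by
  rw [lintegral_workMeasure, lintegral_workMeasure]
  simp_rw [← ENNReal.tsum_mul_left]
  rw [ENNReal.tsum_comm]
  refine tsum_congr fun b => tsum_congr fun b' => ?_
  have h1 := Γ.enorm_amplitude_inverse (s, b) (s', b')
  have h2 := Γ.work_inverse (s, b) (s', b')
  -- By definition of the work, E_{s'} - E_s + w = ε_b - ε_{b'}, which is the exponent in the ratio
  -- of the Gibbs weights.
  have h3 : ENNReal.ofReal (Γ.inverse.B.gibbs b') = ENNReal.ofReal (Γ.B.gibbs b) *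
      ENNReal.ofReal (Real.exp (β * (E' s' - E s + Γ.work (s, b) (s', b')))) := by
    have hnn : 0 ≤ Γ.B.gibbs b := div_nonneg (Real.exp_pos _).le Γ.B.partition_pos.le
    rw [← ENNReal.ofReal_mul hnn]
    congr 1
    change Γ.B.gibbs b' = _
    unfold Bath.gibbs
    rw [div_mul_eq_mul_div, ← Real.exp_add]
    congr 2
    simp only [work]
    ring
  erw [h1, h2, h3]
  ring

/-- Reversibility with `f = 1`: the left side is the total probability of the inverse operation
started in `s'`. -/
theorem secondLawEquality_of_hasWorkMap (Γ : ThermalOperation β E E')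
    {t : Fin d → ProbabilityMeasure (Fin d × ℝ)} (h : Γ.HasWorkMap t) :
    SecondLawEquality β E E' t := by
  rw [secondLawEquality_iff]
  intro s'
  rw [← Γ.inverse.sum_workMeasure_univ s']
  refine Finset.sum_congr rfl fun s _ => ?_
  rw [(Γ.hasWorkMap_iff t).1 h, ← lintegral_one, lintegral_workMeasure_inverse]
  simp only [mul_one]

end ThermalOperation

/-! ### Weak limits and necessity of the second law equality -/

section

variable {d : ℕ}

/-- Fixing the final level cuts out a clopen set, so a test function on one sector extends by zero
to a bounded continuous one. -/
theorem tendsto_lintegral_sector {μn : ℕ → ProbabilityMeasure (Fin d × ℝ)}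
    {μ : ProbabilityMeasure (Fin d × ℝ)} (h : Tendsto μn atTop (𝓝 μ)) (s' : Fin d)
    {f : ℝ → NNReal} (hf : Continuous f) {C : NNReal} (hC : ∀ w, f w ≤ C) :
    Tendsto (fun n => ∫⁻ w, f w ∂(sector (μn n : Measure (Fin d × ℝ)) s')) atTop
      (𝓝 (∫⁻ w, f w ∂(sector (μ : Measure (Fin d × ℝ)) s'))) := by
  have hcont : Continuous fun z : Fin d × ℝ => if z.1 = s' then f z.2 else 0 := by
    rw [continuous_prod_of_discrete_left]
    intro a
    by_cases ha : a = s' <;> simp only [ha, if_true, if_false]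
    · exact hf
    · exact continuous_const
  have hbd : ∀ z : Fin d × ℝ, (if z.1 = s' then f z.2 else 0) ≤ C := fun z => by
    split_ifs
    · exact hC _
    · exact zero_le
  let g : BoundedContinuousFunction (Fin d × ℝ) NNReal :=
    BoundedContinuousFunction.mkOfBound ⟨_, hcont⟩ C fun x y => by
      rw [NNReal.dist_eq]
      refine abs_sub_le_of_nonneg_of_le (NNReal.coe_nonneg _) ?_ (NNReal.coe_nonneg _) ?_
      · exact hbd x
      · exact hbd y
  have hg : ∀ ν : ProbabilityMeasure (Fin d × ℝ), ∫⁻ z, g z ∂(ν : Measure (Fin d × ℝ)) =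
      ∫⁻ w, f w ∂(sector (ν : Measure (Fin d × ℝ)) s') := fun ν => by
    rw [lintegral_sector _ _ (by fun_prop), ← lintegral_indicator (measurableSet_fst_eq s')]
    refine lintegral_congr fun z => ?_
    change ((if z.1 = s' then f z.2 else 0 : NNReal) : ENNReal) = _
    rw [Set.indicator_apply]
    simp only [Set.mem_ofPred_eq]
    split_ifs <;> simp
  have := (ProbabilityMeasure.tendsto_iff_forall_lintegral_tendsto.1 h) g
  simpa only [hg] using this

/-- Lower bounds suffice because total masses are fixed at 1 (portmanteau). The sum over sectors
passes through the liminf by Fatou for the counting measure. -/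
theorem tendsto_of_forall_isOpen_sector_le_liminf {μn : ℕ → ProbabilityMeasure (Fin d × ℝ)}
    {μ : ProbabilityMeasure (Fin d × ℝ)}
    (h : ∀ (s' : Fin d) (S : Set ℝ), IsOpen S → sector (μ : Measure (Fin d × ℝ)) s' S ≤
      liminf (fun n => sector (μn n : Measure (Fin d × ℝ)) s' S) atTop) :
    Tendsto μn atTop (𝓝 μ) := by
  refine tendsto_of_forall_isOpen_le_liminf' fun G hG => ?_
  have hS : ∀ s', IsOpen {w : ℝ | (s', w) ∈ G} := fun s' => hG.preimage (by fun_prop)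
  simp_rw [measure_eq_sum_sector _ hG.measurableSet]
  refine (Finset.sum_le_sum fun s' _ => h s' _ (hS s')).trans ?_
  have := lintegral_liminf_le (μ := Measure.count) (u := atTop)
    (f := fun (n : ℕ) (s' : Fin d) => sector (μn n : Measure (Fin d × ℝ)) s' {w | (s', w) ∈ G})
    (fun n => measurable_of_finite _)
  simpa only [lintegral_count, tsum_fintype] using this

/-- The Boltzmann factor relating a transition and its reverse. -/
def boltzmann (β c w : ℝ) : NNReal := Real.toNNReal (Real.exp (β * (c + w)))

theorem coe_boltzmann (β c w : ℝ) :
    (boltzmann β c w : ENNReal) = ENNReal.ofReal (Real.exp (β * (c + w))) := rfl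

theorem continuous_boltzmann (β c : ℝ) : Continuous (boltzmann β c) := by
  unfold boltzmann; fun_prop

theorem boltzmann_mul_neg (β c w : ℝ) : boltzmann β c w * boltzmann (-β) c w = 1 := by
  rw [boltzmann, boltzmann, ← Real.toNNReal_mul (Real.exp_pos _).le, ← Real.exp_add]
  simp

theorem lintegral_sector_reverse_of_tendsto {β c : ℝ} {s s' : Fin d}
    {tn rn : ℕ → ProbabilityMeasure (Fin d × ℝ)} {t r : ProbabilityMeasure (Fin d × ℝ)}
    (ht : Tendsto tn atTop (𝓝 t)) (hr : Tendsto rn atTop (𝓝 r))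
    (h : ∀ n, ∀ f : ℝ → ENNReal, ∫⁻ w, f w ∂(sector (rn n : Measure (Fin d × ℝ)) s) =
      ∫⁻ w, boltzmann β c w * f (-w) ∂(sector (tn n : Measure (Fin d × ℝ)) s')) :
    sector (r : Measure (Fin d × ℝ)) s Set.univ =
      ∫⁻ w, boltzmann β c w ∂(sector (t : Measure (Fin d × ℝ)) s') := by
  -- The test function is chosen so that multiplication by the Boltzmann factor turns it into min
  -- (boltzmann, K). Both sides are then bounded and continuous and survive the weak limit; monotone
  -- convergence in `K` removes the truncation.
  have htrunc : ∀ K : ℕ, ∫⁻ w, (min 1 (K * boltzmann (-β) c (-w)) : NNReal)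
      ∂(sector (r : Measure (Fin d × ℝ)) s) =
      ∫⁻ w, (min (boltzmann β c w) K : NNReal) ∂(sector (t : Measure (Fin d × ℝ)) s') := by
    intro K
    have hcb := continuous_boltzmann (-β) c
    have hcb' := continuous_boltzmann β c
    refine tendsto_nhds_unique
      (tendsto_lintegral_sector hr s (by fun_prop) fun w => min_le_left _ _) ?_
    convert tendsto_lintegral_sector ht s' (hcb'.min continuous_const)
      (fun w => min_le_right _ (K : NNReal)) using 2 with n
    rw [h n]
    refine lintegral_congr fun w => ?_
    rw [← ENNReal.coe_mul, neg_neg, mul_min, mul_one, mul_left_comm, boltzmann_mul_neg, mul_one]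
  have hlim : ∀ (ν : Measure ℝ) (f : ℕ → ℝ → NNReal) (g : ℝ → NNReal), (∀ K, Continuous (f K)) →
      (∀ w, Monotone fun K => f K w) → (∀ w, ∀ᶠ K in atTop, f K w = g w) →
      Tendsto (fun K => ∫⁻ w, f K w ∂ν) atTop (𝓝 (∫⁻ w, g w ∂ν)) := by
    intro ν f g hf hmono hev
    refine lintegral_tendsto_of_tendsto_of_monotone
      (fun K => (hf K).measurable.coe_nnreal_ennreal.aemeasurable)
      (ae_of_all _ fun w K L hKL => ENNReal.coe_le_coe.2 (hmono w hKL)) (ae_of_all _ fun w => ?_)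
    refine tendsto_const_nhds.congr' ?_
    filter_upwards [hev w] with K hK
    rw [hK]
  have hcb := continuous_boltzmann (-β) c
  have hcb' := continuous_boltzmann β c
  have hpos : ∀ w, 0 < boltzmann (-β) c w := fun w => Real.toNNReal_pos.2 (Real.exp_pos _)
  have h1 := hlim (sector (r : Measure (Fin d × ℝ)) s)
    (fun K w => min 1 (K * boltzmann (-β) c (-w))) (fun _ => 1) (fun K => by fun_prop)
    (fun w K L hKL => min_le_min_left _ (mul_le_mul_left (by exact_mod_cast hKL) _))
    (fun w => by
      obtain ⟨K, hK⟩ := exists_nat_ge (boltzmann (-β) c (-w))⁻¹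
      filter_upwards [eventually_ge_atTop K] with L hL
      refine min_eq_left ?_
      have : (boltzmann (-β) c (-w))⁻¹ ≤ (L : NNReal) := hK.trans (by exact_mod_cast hL)
      rwa [inv_le_iff_one_le_mul₀ (hpos _)] at this)
  have h2 := hlim (sector (t : Measure (Fin d × ℝ)) s')
    (fun K w => min (boltzmann β c w) K) (boltzmann β c) (fun K => by fun_prop)
    (fun w K L hKL => min_le_min_left _ (by exact_mod_cast hKL))
    (fun w => by
      obtain ⟨K, hK⟩ := exists_nat_ge (boltzmann β c w)
      filter_upwards [eventually_ge_atTop K] with L hL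
      exact min_eq_left (hK.trans (by exact_mod_cast hL)))
  simp only [htrunc] at h1
  simpa using tendsto_nhds_unique h1 h2

theorem ThermalOperation.HasWorkMap.lintegral_sector_inverse {β : ℝ} {E E' : Fin d → ℝ}
    {Γ : ThermalOperation β E E'} {t r : Fin d → ProbabilityMeasure (Fin d × ℝ)}
    (ht : Γ.HasWorkMap t) (hr : Γ.inverse.HasWorkMap r) (s s' : Fin d) (f : ℝ → ENNReal) :
    ∫⁻ w, f w ∂(sector (r s' : Measure (Fin d × ℝ)) s) =
      ∫⁻ w, boltzmann β (E' s' - E s) w * f (-w) ∂(sector (t s : Measure (Fin d × ℝ)) s') := by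
  rw [(Γ.hasWorkMap_iff t).1 ht, (Γ.inverse.hasWorkMap_iff r).1 hr,
    Γ.lintegral_workMeasure_inverse]
  rfl

theorem secondLawEquality_of_comesFromThermalOperation {β : ℝ} {E E' : Fin d → ℝ}
    {t : Fin d → ProbabilityMeasure (Fin d × ℝ)} (h : ComesFromThermalOperation β E E' t) :
    SecondLawEquality β E E' t := by
  obtain ⟨Γ, tn, rn, r, htn, hrn, ht, hr⟩ := h
  rw [secondLawEquality_iff]
  intro s'
  rw [tendsto_pi_nhds] at ht hr
  rw [← measure_univ (μ := (r s' : Measure (Fin d × ℝ))), ← sum_sector_univ]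
  refine Finset.sum_congr rfl fun s _ => ?_
  rw [lintegral_sector_reverse_of_tendsto (ht s) (hr s')
    fun n => (htn n).lintegral_sector_inverse (hrn n) s s']
  rfl

end

/-! ### Thermal operations that permute energy eigenstates -/

section

section Transport

variable {d : ℕ} {ι : Type}

/-- Permute the components by `π` and translate each of them. -/
def transport (π : Equiv.Perm (Fin d × ι)) (a : Fin d × ι → ℝ) :
    JointSpace d ι →ₗᵢ[ℂ] JointSpace d ι where
  toFun ψ := ⟨fun i => translate (a i) (ψ (π i)), memℓp_gen (by
    simp only [ThermalOperation.norm_translate]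
    exact (π.summable_iff (f := fun i => ‖ψ i‖ ^ (2 : ENNReal).toReal)).2
      ((memℓp_gen_iff (by norm_num)).1 (lp.memℓp ψ)))⟩
  map_add' ψ χ := lp.ext (funext fun i => (translateₗᵢ (a i)).map_add (ψ (π i)) (χ (π i)))
  map_smul' v ψ := lp.ext (funext fun i => translate_smul (a i) v (ψ (π i)))
  norm_map' ψ := by
    rw [lp.norm_eq_tsum_rpow (by norm_num), lp.norm_eq_tsum_rpow (by norm_num)]
    congr 1
    rw [← π.tsum_eq fun i => ‖ψ i‖ ^ (2 : ENNReal).toReal]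
    exact tsum_congr fun i => congrArg (· ^ _) (ThermalOperation.norm_translate _ _)

theorem transport_apply (π : Equiv.Perm (Fin d × ι)) (a : Fin d × ι → ℝ) (ψ : JointSpace d ι)
    (i : Fin d × ι) : transport π a ψ i = translate (a i) (ψ (π i)) := rfl

theorem transport_surjective (π : Equiv.Perm (Fin d × ι)) (a : Fin d × ι → ℝ) :
    Function.Surjective (transport π a) := fun ψ =>
  ⟨transport π.symm (fun i => -a (π.symm i)) ψ, lp.ext (funext fun i => by
    rw [transport_apply, transport_apply, translate_translate, π.symm_apply_apply, add_neg_cancel,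
      translate_zero])⟩

end Transport

variable {d : ℕ} {β : ℝ}

/-- The thermal operation that permutes the energy eigenstates of system and bath, the weight
providing the difference of energies. -/
def permutationOperation (E E' : Fin d → ℝ) (B : Bath β) (π : Equiv.Perm (Fin d × B.ι)) :
    ThermalOperation β E E' where
  B := B
  U := LinearIsometryEquiv.ofSurjective
    (transport π.symm fun i' => E (π.symm i').1 + B.ε (π.symm i').2 - E' i'.1 - B.ε i'.2)
    (transport_surjective _ _)
  energy t ψ := by
    refine lp.ext (funext fun i' => ?_)
    rw [LinearIsometryEquiv.coe_ofSurjective, transport_apply, evolve_apply, evolve_apply,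
      transport_apply, translate_smul, translate_weightPhase, smul_smul, ← Complex.exp_add]
    congr 2
    push_cast
    ring
  translation a ψ := by
    refine lp.ext (funext fun i' => ?_)
    rw [LinearIsometryEquiv.coe_ofSurjective, transport_apply, jointTranslate_apply,
      jointTranslate_apply, transport_apply, translate_translate, translate_translate, add_comm]

theorem amplitude_permutationOperation (E E' : Fin d → ℝ) (B : Bath β)
    (π : Equiv.Perm (Fin d × B.ι)) (i : Fin d × B.ι) :
    (permutationOperation E E' B π).amplitude i (π i) = 1 := by
  have h := (permutationOperation E E' B π).U_productVector i (π i) gaussianState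
  have h' : (permutationOperation E E' B π).U (productVector i.1 i.2 gaussianState) (π i) =
      translate ((permutationOperation E E' B π).work i (π i)) gaussianState := by
    change translate (E (π.symm (π i)).1 + B.ε (π.symm (π i)).2 - E' (π i).1 - B.ε (π i).2)
      (productVector i.1 i.2 gaussianState (π.symm (π i))) = _
    rw [π.symm_apply_apply, productVector_apply_self]
    rfl
  have hne : translate ((permutationOperation E E' B π).work i (π i)) gaussianState ≠ 0 := by
    rw [← norm_ne_zero_iff, ThermalOperation.norm_translate, norm_ne_zero_iff]
    exact ThermalOperation.gaussianState_ne_zero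
  rw [h'] at h
  refine smul_left_injective ℂ hne ?_
  simp only [one_smul]
  exact h.symm

/-- A permutation with prescribed minimal numbers of transitions between the fibres of a map. -/
theorem exists_perm_le_card_filter {X L : Type*} [Fintype X] [Fintype L] [DecidableEq X]
    [DecidableEq L] (ℓ : X → L) (m : L → L → ℕ)
    (hrow : ∀ x, ∑ y, m x y ≤ Fintype.card {a // ℓ a = x})
    (hcol : ∀ y, ∑ x, m x y ≤ Fintype.card {a // ℓ a = y}) :
    ∃ π : Equiv.Perm X, ∀ x y, m x y ≤
      (Finset.univ.filter fun a => ℓ a = x ∧ ℓ (π a) = y).card := by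
  have h1 : ∀ x, Nonempty ((Σ y, Fin (m x y)) ↪ {a // ℓ a = x}) := fun x =>
    Function.Embedding.nonempty_of_card_le (by simpa using hrow x)
  have h2 : ∀ y, Nonempty ((Σ x, Fin (m x y)) ↪ {a // ℓ a = y}) := fun y =>
    Function.Embedding.nonempty_of_card_le (by simpa using hcol y)
  -- Every required transition from `x` to `y` receives its own source in the fibre of `x` and its
  -- own target in the fibre of `y`. The partial bijection from sources to targets extends to the
  -- finite set `X`.
  let f : (Σ x, Σ y, Fin (m x y)) → X := fun p => (h1 p.1).some p.2
  let g : (Σ x, Σ y, Fin (m x y)) → X := fun p => (h2 p.2.1).some ⟨p.1, p.2.2⟩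
  have hfℓ : ∀ p, ℓ (f p) = p.1 := fun p => ((h1 p.1).some p.2).2
  have hgℓ : ∀ p, ℓ (g p) = p.2.1 := fun p => ((h2 p.2.1).some ⟨p.1, p.2.2⟩).2
  have hf : Function.Injective f := by
    rintro ⟨x, p⟩ ⟨x', p'⟩ h
    obtain rfl : x = x' :=
      (hfℓ ⟨x, p⟩).symm.trans ((congrArg ℓ h).trans (hfℓ ⟨x', p'⟩))
    exact congrArg (Sigma.mk x) ((h1 x).some.injective (Subtype.ext h))
  have hg : Function.Injective g := by
    rintro ⟨x, y, k⟩ ⟨x', y', k'⟩ h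
    obtain rfl : y = y' :=
      (hgℓ ⟨x, y, k⟩).symm.trans ((congrArg ℓ h).trans (hgℓ ⟨x', y', k'⟩))
    have := (h2 y).some.injective (Subtype.ext h)
    simp only [Sigma.mk.injEq] at this
    obtain ⟨rfl, h⟩ := this
    rw [eq_of_heq h]
  classical
  let e : {a // a ∈ Set.range f} ≃ {a // a ∈ Set.range g} :=
    (Equiv.ofInjective f hf).symm.trans (Equiv.ofInjective g hg)
  have hπ : ∀ p, e.extendSubtype (f p) = g p := fun p => by
    rw [e.extendSubtype_apply_of_mem _ ⟨p, rfl⟩]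
    change ((Equiv.ofInjective g hg) ((Equiv.ofInjective f hf).symm ⟨f p, _⟩) : X) = g p
    rw [Equiv.ofInjective_symm_apply hf p]
    rfl
  refine ⟨e.extendSubtype, fun x y => ?_⟩
  rw [← Fintype.card_fin (m x y), ← Finset.card_univ]
  refine Finset.card_le_card_of_injOn (fun k => f ⟨x, y, k⟩) (fun k _ => ?_) fun k _ k' _ h => ?_
  · simp [hfℓ, hπ, hgℓ]
  · simpa using hf h

end

/-! ### Finite baths with nearly equiprobable levels -/

/-- The number of bath states of energy `δ j`; it grows like the Boltzmann factor. -/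
def degeneracy (β δ : ℝ) (M j : ℕ) : ℕ := ⌊M * Real.exp (β * (δ * j))⌋₊

/-- A bath whose energies `0, δ, …, (K - 1) δ` are nearly equally likely in the Gibbs state. -/
def gridBath (β δ : ℝ) {K M : ℕ} (hK : 0 < K) (hM : 0 < M) : Bath β where
  ι := Σ j : Fin K, Fin (degeneracy β δ M j)
  nonempty := ⟨⟨⟨0, hK⟩, ⟨0, by simpa [degeneracy] using hM⟩⟩⟩
  ε b := δ * (b.1 : ℕ)
  summable := (hasSum_fintype _).summable

instance (β δ : ℝ) {K M : ℕ} (hK : 0 < K) (hM : 0 < M) : Fintype (gridBath β δ hK hM).ι :=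
  inferInstanceAs (Fintype (Σ j : Fin K, Fin (degeneracy β δ M j)))

/-- The energy level of a bath state. -/
def level {β δ : ℝ} {K M : ℕ} {hK : 0 < K} {hM : 0 < M} (b : (gridBath β δ hK hM).ι) : Fin K := b.1

theorem gridBath_ε {β δ : ℝ} {K M : ℕ} (hK : 0 < K) (hM : 0 < M) (b : (gridBath β δ hK hM).ι) :
    (gridBath β δ hK hM).ε b = δ * (level b : ℕ) := rfl

/-- Degeneracy cancels the Boltzmann factor up to the floor, so each level contributes at most `M`.
The floor errs in the direction needed for a lower bound on Gibbs weights. -/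
theorem partition_gridBath_le (β δ : ℝ) {K M : ℕ} (hK : 0 < K) (hM : 0 < M) :
    (gridBath β δ hK hM).partition ≤ K * M := by
  have h : (gridBath β δ hK hM).partition =
      ∑ b : (Σ j : Fin K, Fin (degeneracy β δ M j)), Real.exp (-β * (δ * (b.1 : ℕ))) :=
    tsum_fintype _
  rw [h, Fintype.sum_sigma]
  simp only [Finset.sum_const, Finset.card_univ, Fintype.card_fin, nsmul_eq_mul]
  calc ∑ j : Fin K, (degeneracy β δ M j : ℝ) * Real.exp (-β * (δ * (j : ℕ)))
      ≤ ∑ _j : Fin K, (M : ℝ) := by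
        refine Finset.sum_le_sum fun j _ => ?_
        calc _ ≤ M * Real.exp (β * (δ * (j : ℕ))) * Real.exp (-β * (δ * (j : ℕ))) := by
              gcongr
              exact Nat.floor_le (by positivity)
          _ = M := by
              rw [mul_assoc, ← Real.exp_add, neg_mul, add_neg_cancel, Real.exp_zero, mul_one]
    _ = K * M := by simp

theorem le_gibbs_gridBath {β δ : ℝ} {K M : ℕ} (hK : 0 < K) (hM : 0 < M)
    (b : (gridBath β δ hK hM).ι) :
    Real.exp (-(β * (δ * (level b : ℕ)))) / (K * M) ≤ (gridBath β δ hK hM).gibbs b := by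
  rw [Bath.gibbs, gridBath_ε, neg_mul]
  gcongr
  · exact Bath.partition_pos _
  · exact partition_gridBath_le β δ hK hM

theorem degeneracy_le_card {d : ℕ} {β δ : ℝ} {K M : ℕ} (hK : 0 < K) (hM : 0 < M)
    (x : Fin d × Fin K) : degeneracy β δ M x.2 ≤
      Fintype.card {a : Fin d × (gridBath β δ hK hM).ι // (a.1, level a.2) = x} := by
  rw [← Fintype.card_fin (degeneracy β δ M x.2)]
  refine Fintype.card_le_of_injective
    (fun k : Fin (degeneracy β δ M x.2) => ⟨(x.1, (⟨x.2, k⟩ : (gridBath β δ hK hM).ι)), rfl⟩) ?_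
  intro k k' h
  have h1 := congrArg (fun a => a.1.2) h
  exact eq_of_heq (Sigma.mk.inj h1).2

/-- A permutation realizing the counts contributes at least the Gibbs weight of its source for each
prescribed transition. States moved otherwise only add mass, hence an inequality. -/
theorem exists_thermalOperation_of_counts {d : ℕ} {β δ : ℝ} {E E' : Fin d → ℝ} {K M : ℕ}
    (hK : 0 < K) (hM : 0 < M) (m : Fin d × Fin K → Fin d × Fin K → ℕ)
    (hrow : ∀ x, ∑ y, m x y ≤ degeneracy β δ M x.2)
    (hcol : ∀ y, ∑ x, m x y ≤ degeneracy β δ M y.2) :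
    ∃ Γ : ThermalOperation β E E', ∀ s s' (f : ℝ → ENNReal),
      ∑ j : Fin K, ∑ j' : Fin K, m (s, j) (s', j') *
        (ENNReal.ofReal (Real.exp (-(β * (δ * (j : ℕ)))) / (K * M)) *
          f (E s - E' s' + δ * ((j : ℕ) - (j' : ℕ)))) ≤ ∫⁻ w, f w ∂(Γ.workMeasure s s') := by
  classical
  obtain ⟨π, hπ⟩ := exists_perm_le_card_filter
    (fun a : Fin d × (gridBath β δ hK hM).ι => (a.1, level a.2)) m
    (fun x => (hrow x).trans (degeneracy_le_card hK hM x))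
    (fun y => (hcol y).trans (degeneracy_le_card hK hM y))
  refine ⟨permutationOperation E E' (gridBath β δ hK hM) π, fun s s' f => ?_⟩
  set C : Fin K → Fin K → ENNReal := fun j j' =>
    ENNReal.ofReal (Real.exp (-(β * (δ * (j : ℕ)))) / (K * M)) *
      f (E s - E' s' + δ * ((j : ℕ) - (j' : ℕ)))
  have hcount : ∑ j, ∑ j', m (s, j) (s', j') * C j j' ≤
      ∑ a : Fin d × (gridBath β δ hK hM).ι,
        if a.1 = s ∧ (π a).1 = s' then C (level a.2) (level (π a).2) else 0 := by
    calc ∑ j, ∑ j', m (s, j) (s', j') * C j j'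
        ≤ ∑ j, ∑ j', ∑ a : Fin d × (gridBath β δ hK hM).ι,
          if (a.1, level a.2) = (s, j) ∧ ((π a).1, level (π a).2) = (s', j') then C j j' else 0 := by
          refine Finset.sum_le_sum fun j _ => Finset.sum_le_sum fun j' _ => ?_
          rw [← Finset.sum_filter, Finset.sum_const, nsmul_eq_mul]
          gcongr
          exact hπ (s, j) (s', j')
      _ = ∑ a : Fin d × (gridBath β δ hK hM).ι, ∑ j, ∑ j',
          if (a.1, level a.2) = (s, j) ∧ ((π a).1, level (π a).2) = (s', j') then C j j' else 0 := by
          symm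
          rw [Finset.sum_comm]
          refine Finset.sum_congr rfl fun j _ => ?_
          rw [Finset.sum_comm]
      _ ≤ _ := by
          refine Finset.sum_le_sum fun a _ => ?_
          by_cases h1 : a.1 = s <;> by_cases h2 : (π a).1 = s' <;>
            simp [h1, h2, Prod.ext_iff, ite_and]
  refine hcount.trans ?_
  rw [Fintype.sum_prod_type, Finset.sum_eq_single s (fun b _ hb => by simp [hb]) (by simp),
    ThermalOperation.lintegral_workMeasure]
  refine (le_of_eq (tsum_fintype (L := .unconditional _) _).symm).trans
    (ENNReal.tsum_le_tsum fun b => ?_)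
  by_cases h : (π (s, b)).1 = s'
  · subst h
    rw [if_pos ⟨rfl, rfl⟩]
    refine mul_le_mul' (ENNReal.ofReal_le_ofReal (le_gibbs_gridBath hK hM b)) ?_
    -- Only the image of `(s, b)` under `π` is kept from the sum over final bath states; its
    -- amplitude is 1.
    refine le_trans (le_of_eq ?_) (ENNReal.le_tsum (π (s, b)).2)
    have h1 := congrArg (fun v : ℂ => ‖v‖ₑ ^ 2)
      (amplitude_permutationOperation E E' (gridBath β δ hK hM) π (s, b))
    simp only [enorm_one, one_pow] at h1
    refine (one_mul _).symm.trans (congrArg₂ (· * ·) h1.symm (congrArg f ?_))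
    change _ = E s + δ * (level b : ℕ) - E' (π (s, b)).1 - δ * (level (π (s, b)).2 : ℕ)
    ring
  · rw [if_neg fun h' => h h'.2]
    exact zero_le

/-! ### Discretizing the work -/

section

/-- The index of the cell `[c + δ k, c + δ (k + 1))` that contains `w`. -/
def cellIndex (δ c w : ℝ) : ℤ := ⌊(w - c) / δ⌋

theorem measurable_cellIndex (δ c : ℝ) : Measurable (cellIndex δ c) :=
  Int.measurable_floor.comp (by fun_prop)

theorem measurableSet_cellIndex_eq (δ c : ℝ) (k : ℤ) : MeasurableSet {w | cellIndex δ c w = k} :=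
  measurable_cellIndex δ c (measurableSet_singleton k)

theorem mul_cellIndex_le {δ : ℝ} (hδ : 0 < δ) (c w : ℝ) : δ * cellIndex δ c w ≤ w - c := by
  have := Int.floor_le ((w - c) / δ)
  rw [le_div_iff₀ hδ] at this
  rw [mul_comm]
  exact this

theorem sum_setLIntegral_cell_le {ι : Type*} [Fintype ι] (δ c : ℝ) (κ : ι → ℤ)
    (hκ : Function.Injective κ) (ν : Measure ℝ) (f : ℝ → ENNReal) :
    ∑ j, ∫⁻ w in {w | cellIndex δ c w = κ j}, f w ∂ν ≤ ∫⁻ w, f w ∂ν := by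
  have hd : Set.PairwiseDisjoint (Finset.univ : Finset ι) fun j => {w | cellIndex δ c w = κ j} :=
    fun i _ j _ hij => Set.disjoint_left.2 fun w (hi : _ = _) (hj : _ = _) =>
      hij (hκ (hi.symm.trans hj))
  have h := lintegral_biUnion_finset (μ := ν) hd
    (fun j _ => measurableSet_cellIndex_eq δ c (κ j)) f
  rw [← h]
  exact setLIntegral_le_lintegral _ _

/-- The exponent uses the left endpoint of the cell, where the Boltzmann factor is smallest.
Discretization therefore preserves the second law as an inequality. -/
theorem ofReal_exp_mul_measure_cell_le {β δ : ℝ} (hβ : 0 ≤ β) (hδ : 0 < δ) (c : ℝ) (k : ℤ)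
    (ν : Measure ℝ) : ENNReal.ofReal (Real.exp (β * (δ * k))) * ν {w | cellIndex δ c w = k} ≤
      ∫⁻ w in {w | cellIndex δ c w = k}, boltzmann β (-c) w ∂ν := by
  rw [← setLIntegral_const]
  refine setLIntegral_mono (continuous_boltzmann β _).measurable.coe_nnreal_ennreal
    fun w (hw : cellIndex δ c w = k) => ?_
  rw [coe_boltzmann, ← hw]
  refine ENNReal.ofReal_le_ofReal (Real.exp_le_exp.2 (mul_le_mul_of_nonneg_left ?_ hβ))
  linarith [mul_cellIndex_le hδ c w]

/-- The number of pairs of levels of a bath of `K` levels with difference `k`. -/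
def pairCount (K : ℕ) (k : ℤ) : ℕ :=
  (Finset.univ.filter fun p : Fin K × Fin K => (p.1 : ℤ) - p.2 = k).card

theorem sub_natAbs_le_pairCount (K : ℕ) (k : ℤ) : K - k.natAbs ≤ pairCount K k := by
  rw [← Fintype.card_fin (K - k.natAbs), ← Finset.card_univ, pairCount]
  -- The pairs (i + k⁺, i + k⁻) with i < K - |k| have difference `k`.
  refine Finset.card_le_card_of_injOn (fun i => (⟨i + k.toNat, by omega⟩, ⟨i + (-k).toNat, by omega⟩))
    (fun i _ => ?_) fun i _ j _ h => ?_
  · simp only [Finset.coe_filter, Finset.mem_univ, true_and, Set.mem_ofPred_eq]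
    push_cast
    omega
  · simp only [Prod.mk.injEq, Fin.mk.injEq] at h
    ext
    omega

variable {d : ℕ} {β : ℝ} {E E' : Fin d → ℝ}

/-- On the left the work is rounded down to its cell endpoint, and `pairCount / K` is the fraction
of level pairs available, below 1 because the bath is bounded. The error `K / M` comes from rounding
counts to integers. The condition on `f` admits both the constant 1 and the Boltzmann factor. -/
theorem exists_thermalOperation_grid (hβ : 0 ≤ β) {t : Fin d → ProbabilityMeasure (Fin d × ℝ)}
    (ht : SecondLawEquality β E E' t) {δ : ℝ} (hδ : 0 < δ) {K M : ℕ} (hK : 0 < K) (hM : 0 < M) :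
    ∃ Γ : ThermalOperation β E E', ∀ s s' (f : ℝ → ENNReal),
      (∀ j j' : ℕ, ENNReal.ofReal (Real.exp (-(β * (δ * j)))) *
        f (E s - E' s' + δ * (j - j')) ≤ 1) →
      ∫⁻ w, pairCount K (cellIndex δ (E s - E' s') w) * (ENNReal.ofReal (1 / K) *
          f (E s - E' s' + δ * cellIndex δ (E s - E' s') w))
            ∂(sector (t s : Measure (Fin d × ℝ)) s') ≤
        ∫⁻ w, f w ∂(Γ.workMeasure s s') + ENNReal.ofReal (K / M) := by
  set ν : Fin d → Fin d → Measure ℝ := fun s s' => sector (t s : Measure (Fin d × ℝ)) s'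
  set cell : Fin d → Fin d → ℤ → Set ℝ := fun s s' k => {w | cellIndex δ (E s - E' s') w = k}
  have hfin : ∀ s s' k, ν s s' (cell s s' k) ≠ ⊤ := fun s s' k => measure_ne_top _ _
  set q : Fin d → Fin d → ℤ → ℝ := fun s s' k => (ν s s' (cell s s' k)).toReal with hq
  have hq0 : ∀ s s' k, 0 ≤ q s s' k := fun s s' k => ENNReal.toReal_nonneg
  have hrow : ∀ s (j : Fin K), ∑ y : Fin d × Fin K, q s y.1 ((j : ℤ) - y.2) ≤ 1 := by
    intro s j
    simp only [hq]
    rw [← ENNReal.toReal_sum fun y _ => hfin _ _ _, ← ENNReal.toReal_one]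
    refine ENNReal.toReal_mono ENNReal.one_ne_top ?_
    rw [Fintype.sum_prod_type, ← measure_univ (μ := (t s : Measure (Fin d × ℝ))),
      ← sum_sector_univ]
    refine Finset.sum_le_sum fun s' _ => ?_
    have := sum_setLIntegral_cell_le δ (E s - E' s') (fun j' : Fin K => (j : ℤ) - j')
      (fun a b h => Fin.ext (by simpa using h)) (ν s s') 1
    simpa using this
  have hcol : ∀ s' (j' : Fin K), ∑ x : Fin d × Fin K,
      Real.exp (β * (δ * ((x.2 : ℕ) - (j' : ℕ)))) * q x.1 s' ((x.2 : ℤ) - j') ≤ 1 := by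
    intro s' j'
    have h1 : ∀ x : Fin d × Fin K,
        Real.exp (β * (δ * ((x.2 : ℕ) - (j' : ℕ)))) * q x.1 s' ((x.2 : ℤ) - j') =
        (ENNReal.ofReal (Real.exp (β * (δ * (((x.2 : ℤ) - j' : ℤ) : ℝ)))) *
          ν x.1 s' (cell x.1 s' ((x.2 : ℤ) - j'))).toReal := fun x => by
      rw [ENNReal.toReal_mul, ENNReal.toReal_ofReal (Real.exp_pos _).le]
      push_cast
      rfl
    simp_rw [h1]
    rw [← ENNReal.toReal_sum fun x _ => ENNReal.mul_ne_top ENNReal.ofReal_ne_top (hfin _ _ _),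
      ← ENNReal.toReal_one]
    refine ENNReal.toReal_mono ENNReal.one_ne_top ?_
    rw [Fintype.sum_prod_type, ← (secondLawEquality_iff β E E' t).1 ht s']
    refine Finset.sum_le_sum fun s _ => ?_
    have h2 : ∀ j ∈ (Finset.univ : Finset (Fin K)), _ := fun j _ =>
      ofReal_exp_mul_measure_cell_le hβ hδ (E s - E' s') ((j : ℤ) - j') (ν s s')
    refine (Finset.sum_le_sum h2).trans
      ((sum_setLIntegral_cell_le δ (E s - E' s') (fun j : Fin K => (j : ℤ) - j')
        (fun a b h => Fin.ext (by simpa using h)) (ν s s') _).trans (le_of_eq ?_))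
    rw [neg_sub]
    rfl
  -- About M exp (β δ j) states sit at level `j`; the share `q` of them is to move. Rows are bounded
  -- by normalization of `t`, columns by the second law equality.
  set m : Fin d × Fin K → Fin d × Fin K → ℕ := fun x y =>
    ⌊M * Real.exp (β * (δ * (x.2 : ℕ))) * q x.1 y.1 ((x.2 : ℤ) - y.2)⌋₊
  have hmle : ∀ x y, (m x y : ℝ) ≤
      M * Real.exp (β * (δ * (x.2 : ℕ))) * q x.1 y.1 ((x.2 : ℤ) - y.2) := fun x y =>
    Nat.floor_le (mul_nonneg (by positivity) (hq0 _ _ _))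
  obtain ⟨Γ, hΓ⟩ := exists_thermalOperation_of_counts (β := β) (δ := δ) (E := E) (E' := E') hK hM m
    (fun x => by
      refine Nat.le_floor ?_
      push_cast
      refine (Finset.sum_le_sum fun y _ => hmle x y).trans ?_
      rw [← Finset.mul_sum]
      exact mul_le_of_le_one_right (by positivity) (hrow x.1 x.2))
    (fun y => by
      refine Nat.le_floor ?_
      push_cast
      calc ∑ x, (m x y : ℝ) ≤ ∑ x : Fin d × Fin K, M * Real.exp (β * (δ * (y.2 : ℕ))) *
            (Real.exp (β * (δ * ((x.2 : ℕ) - (y.2 : ℕ)))) * q x.1 y.1 ((x.2 : ℤ) - y.2)) := by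
            refine Finset.sum_le_sum fun x _ => (hmle x y).trans (le_of_eq ?_)
            have h1 : Real.exp (β * (δ * (x.2 : ℕ))) = Real.exp (β * (δ * (y.2 : ℕ))) *
                Real.exp (β * (δ * ((x.2 : ℕ) - (y.2 : ℕ)))) := by
              rw [← Real.exp_add]
              congr 1
              ring
            rw [h1]
            ring
        _ ≤ M * Real.exp (β * (δ * (y.2 : ℕ))) := by
            rw [← Finset.mul_sum]
            exact mul_le_of_le_one_right (by positivity) (hcol y.1 y.2))
  refine ⟨Γ, fun s s' f hf => ?_⟩
  set c := E s - E' s'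
  have hKr : (0 : ℝ) < K := by exact_mod_cast hK
  have hMr : (0 : ℝ) < M := by exact_mod_cast hM
  have hsplit : ∫⁻ w, pairCount K (cellIndex δ c w) * (ENNReal.ofReal (1 / K) *
      f (c + δ * cellIndex δ c w)) ∂(ν s s') = ∑ p : Fin K × Fin K,
        ν s s' (cell s s' ((p.1 : ℤ) - p.2)) *
          (ENNReal.ofReal (1 / K) * f (c + δ * ((p.1 : ℕ) - (p.2 : ℕ)))) := by
    have h1 : ∀ w, pairCount K (cellIndex δ c w) * (ENNReal.ofReal (1 / K) *
        f (c + δ * cellIndex δ c w)) = ∑ p : Fin K × Fin K,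
          (cell s s' ((p.1 : ℤ) - p.2)).indicator (fun _ =>
            ENNReal.ofReal (1 / K) * f (c + δ * ((p.1 : ℕ) - (p.2 : ℕ)))) w := by
      intro w
      rw [pairCount, ← nsmul_eq_mul, ← Finset.sum_const, Finset.sum_filter]
      refine Finset.sum_congr rfl fun p _ => ?_
      by_cases h : (p.1 : ℤ) - p.2 = cellIndex δ c w
      · rw [if_pos h, Set.indicator_of_mem (show w ∈ cell s s' _ from h.symm), ← h]
        push_cast
        rfl
      · rw [if_neg h, Set.indicator_of_notMem
          (show w ∉ cell s s' ((p.1 : ℤ) - p.2) from fun h' => h h'.symm)]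
    simp_rw [h1]
    rw [lintegral_finsetSum _ fun p _ =>
      measurable_const.indicator (measurableSet_cellIndex_eq δ c _)]
    refine Finset.sum_congr rfl fun p _ => ?_
    rw [lintegral_indicator_const (measurableSet_cellIndex_eq δ c _), mul_comm]
  rw [hsplit]
  have hterm : ∀ p : Fin K × Fin K, ν s s' (cell s s' ((p.1 : ℤ) - p.2)) *
      (ENNReal.ofReal (1 / K) * f (c + δ * ((p.1 : ℕ) - (p.2 : ℕ)))) ≤
      m (s, p.1) (s', p.2) * (ENNReal.ofReal (Real.exp (-(β * (δ * (p.1 : ℕ)))) / (K * M)) *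
        f (c + δ * ((p.1 : ℕ) - (p.2 : ℕ)))) + ENNReal.ofReal (1 / (K * M)) := by
    intro p
    set F := f (c + δ * ((p.1 : ℕ) - (p.2 : ℕ)))
    set e := Real.exp (-(β * (δ * (p.1 : ℕ)))) with he
    -- The floor loses less than one transition per pair of levels; by `hf` each costs at most 1 /
    -- (K M), and there are K² pairs.
    have h1 : q s s' ((p.1 : ℤ) - p.2) * (1 / K) ≤ (m (s, p.1) (s', p.2) + 1) * (e / (K * M)) := by
      have h2 : M * Real.exp (β * (δ * (p.1 : ℕ))) * q s s' ((p.1 : ℤ) - p.2) ≤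
          m (s, p.1) (s', p.2) + 1 := (Nat.lt_floor_add_one _).le
      refine le_trans (le_of_eq ?_) (mul_le_mul_of_nonneg_right h2 (by positivity))
      rw [he, Real.exp_neg]
      field_simp
    calc ν s s' (cell s s' ((p.1 : ℤ) - p.2)) * (ENNReal.ofReal (1 / K) * F)
        = ENNReal.ofReal (q s s' ((p.1 : ℤ) - p.2) * (1 / K)) * F := by
          rw [ENNReal.ofReal_mul (hq0 _ _ _), hq, ENNReal.ofReal_toReal (hfin _ _ _), mul_assoc]
      _ ≤ ENNReal.ofReal ((m (s, p.1) (s', p.2) + 1) * (e / (K * M))) * F := by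
          gcongr
      _ = m (s, p.1) (s', p.2) * (ENNReal.ofReal (e / (K * M)) * F) +
          ENNReal.ofReal (e / (K * M)) * F := by
          rw [ENNReal.ofReal_mul (by positivity), ENNReal.ofReal_add (by positivity) one_pos.le,
            ENNReal.ofReal_natCast, ENNReal.ofReal_one]
          ring
      _ ≤ _ := by
          gcongr
          rw [div_eq_mul_one_div, mul_comm e, ENNReal.ofReal_mul (by positivity), mul_assoc]
          exact mul_le_of_le_one_right' (hf p.1 p.2)
  refine (Finset.sum_le_sum fun p _ => hterm p).trans ?_
  rw [Finset.sum_add_distrib, Fintype.sum_prod_type]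
  refine add_le_add (hΓ s s' f) (le_of_eq ?_)
  rw [Finset.sum_const, Finset.card_univ, Fintype.card_prod, Fintype.card_fin,
    ← ENNReal.ofReal_nsmul, nsmul_eq_mul]
  congr 1
  push_cast
  field_simp

end

/-! ### The limit of large baths and sufficiency -/

section

theorem tendsto_mul_cellIndex {δ : ℕ → ℝ} (hδ : ∀ n, 0 < δ n) (hδ0 : Tendsto δ atTop (𝓝 0))
    (c w : ℝ) : Tendsto (fun n => c + δ n * cellIndex (δ n) c w) atTop (𝓝 w) := by
  have h1 : Tendsto (fun n => w - δ n) atTop (𝓝 w) := by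
    simpa using tendsto_const_nhds.sub hδ0
  refine tendsto_of_tendsto_of_tendsto_of_le_of_le h1 tendsto_const_nhds (fun n => ?_) fun n => ?_
  · have := Int.lt_floor_add_one ((w - c) / δ n)
    rw [div_lt_iff₀ (hδ n)] at this
    simp only [cellIndex]
    linarith
  · simp only
    linarith [mul_cellIndex_le (hδ n) c w]

theorem abs_cellIndex_le (n : ℕ) (c w : ℝ) :
    |(cellIndex (1 / ((n : ℝ) + 1)) c w : ℝ)| ≤ (|w - c| + 1) * (n + 1) := by
  have hn : (0 : ℝ) < n + 1 := by positivity
  have h1 := Int.floor_le ((w - c) / (1 / ((n : ℝ) + 1)))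
  have h2 := Int.lt_floor_add_one ((w - c) / (1 / ((n : ℝ) + 1)))
  rw [div_div_eq_mul_div, div_one] at h1 h2
  have h3 := mul_le_mul_of_nonneg_right (le_abs_self (w - c)) hn.le
  have h4 := mul_le_mul_of_nonneg_right (neg_abs_le (w - c)) hn.le
  rw [cellIndex, div_div_eq_mul_div, div_one, abs_le]
  constructor <;> nlinarith

theorem one_sub_le_pairCount_div {K : ℕ} (hK : 0 < K) (k : ℤ) :
    1 - |(k : ℝ)| / K ≤ pairCount K k * (1 / K) := by
  have hKr : (0 : ℝ) < K := by exact_mod_cast hK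
  have h : (K : ℝ) ≤ pairCount K k + |(k : ℝ)| := by
    rw [← Int.cast_abs, ← Nat.cast_natAbs]
    exact_mod_cast Nat.sub_le_iff_le_add.1 (sub_natAbs_le_pairCount K k)
  rw [mul_one_div, le_div_iff₀ hKr, sub_mul, div_mul_cancel₀ _ hKr.ne', one_mul]
  linarith

/-- Pointwise input for Fatou. Cell endpoints converge to `w` and eventually lie in the open set
`T`, while |k| / K ≤ (|w - c| + 1) / (n + 1) makes edge effects of the bath vanish. -/
theorem indicator_le_liminf_pairCount (c : ℝ) {T : Set ℝ} (hT : IsOpen T) {g : ℝ → NNReal}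
    (hg : Continuous g) (w : ℝ) :
    T.indicator (fun w => (g w : ENNReal)) w ≤ liminf (fun n : ℕ =>
      pairCount ((n + 1) ^ 2) (cellIndex (1 / ((n : ℝ) + 1)) c w) *
        (ENNReal.ofReal (1 / ((n + 1) ^ 2 : ℕ)) * T.indicator (fun w => (g w : ENNReal))
          (c + 1 / ((n : ℝ) + 1) * cellIndex (1 / ((n : ℝ) + 1)) c w))) atTop := by
  by_cases hw : w ∈ T
  swap
  · rw [Set.indicator_of_notMem hw]
    exact zero_le
  have hu := tendsto_mul_cellIndex (δ := fun n : ℕ => 1 / ((n : ℝ) + 1)) (fun n => by positivity)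
    tendsto_one_div_add_atTop_nhds_zero_nat c w
  have hr : Tendsto (fun n : ℕ => 1 - (|w - c| + 1) * (1 / ((n : ℝ) + 1))) atTop (𝓝 1) := by
    simpa using tendsto_const_nhds.sub
      (tendsto_one_div_add_atTop_nhds_zero_nat.const_mul (|w - c| + 1))
  have hlim : Tendsto (fun n : ℕ => ENNReal.ofReal (1 - (|w - c| + 1) * (1 / ((n : ℝ) + 1))) *
      (g (c + 1 / ((n : ℝ) + 1) * cellIndex (1 / ((n : ℝ) + 1)) c w) : ENNReal)) atTop
      (𝓝 (g w)) := by
    have h1 := ENNReal.tendsto_ofReal hr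
    rw [ENNReal.ofReal_one] at h1
    have h2 := ENNReal.tendsto_coe.2 ((hg.tendsto w).comp hu)
    simpa using ENNReal.Tendsto.mul h1 (Or.inl one_ne_zero) h2 (Or.inr ENNReal.one_ne_top)
  rw [Set.indicator_of_mem hw, ← hlim.liminf_eq]
  refine liminf_le_liminf ?_
  filter_upwards [hu.eventually (hT.mem_nhds hw)] with n hn
  rw [Set.indicator_of_mem hn, ← mul_assoc, ← ENNReal.ofReal_natCast,
    ← ENNReal.ofReal_mul (Nat.cast_nonneg _)]
  gcongr
  refine le_trans ?_ (one_sub_le_pairCount_div (by positivity) _)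
  gcongr
  rw [div_le_iff₀ (by positivity)]
  refine (abs_cellIndex_le n c w).trans (le_of_eq ?_)
  push_cast
  field_simp

variable {d : ℕ} {β : ℝ} {E E' : Fin d → ℝ}

theorem exists_thermalOperation_seq (hβ : 0 ≤ β) {t : Fin d → ProbabilityMeasure (Fin d × ℝ)}
    (ht : SecondLawEquality β E E' t) :
    ∃ Γ : ℕ → ThermalOperation β E E', ∀ s s' (T : Set ℝ) (g : ℝ → NNReal), IsOpen T →
      Continuous g → (∀ δ : ℝ, 0 ≤ δ → ∀ j j' : ℕ, ENNReal.ofReal (Real.exp (-(β * (δ * j)))) *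
        g (E s - E' s' + δ * (j - j')) ≤ 1) →
      ∫⁻ w in T, g w ∂(sector (t s : Measure (Fin d × ℝ)) s') ≤
        liminf (fun n => ∫⁻ w in T, g w ∂((Γ n).workMeasure s s')) atTop := by
  -- The cell width 1 / (n + 1) tends to 0, the bath's energy range K δ grows like n + 1, and the
  -- rounding error K / M is 1 / (n + 1).
  choose Γ hΓ using fun n : ℕ => exists_thermalOperation_grid (E := E) (E' := E') hβ ht
    (δ := 1 / ((n : ℝ) + 1)) (by positivity) (K := (n + 1) ^ 2) (M := (n + 1) ^ 3)
    (by positivity) (by positivity)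
  refine ⟨Γ, fun s s' T g hT hg hbound => ?_⟩
  set f : ℝ → ENNReal := T.indicator fun w => (g w : ENNReal)
  have herr : Tendsto (fun n : ℕ => ENNReal.ofReal (((n + 1) ^ 2 : ℕ) / ((n + 1) ^ 3 : ℕ))) atTop
      (𝓝 0) := by
    rw [← ENNReal.ofReal_zero]
    refine ENNReal.tendsto_ofReal (tendsto_one_div_add_atTop_nhds_zero_nat.congr fun n => ?_)
    push_cast
    field_simp
  have hle : ∀ n : ℕ, _ := fun n => hΓ n s s' f fun j j' => by
    refine le_trans ?_ (hbound (1 / ((n : ℝ) + 1)) (by positivity) j j')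
    gcongr
    exact Set.indicator_le_self' (fun _ _ => zero_le) _
  simp_rw [← lintegral_indicator hT.measurableSet]
  rw [← ENNReal.liminf_add_of_right_tendsto_zero herr]
  refine le_trans ?_ (liminf_le_liminf (Eventually.of_forall hle))
  refine (lintegral_mono (indicator_le_liminf_pairCount (E s - E' s') hT hg)).trans
    (lintegral_liminf_le fun n => ?_)
  exact (Measurable.of_discrete (f := fun k : ℤ => (pairCount ((n + 1) ^ 2) k : ENNReal) *
    (ENNReal.ofReal (1 / ((n + 1) ^ 2 : ℕ)) * f (E s - E' s' + 1 / ((n : ℝ) + 1) * k)))).comp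
    (measurable_cellIndex _ _)

/-- The conditional distribution of the reversed transitions. -/
def reverseMeasure (β : ℝ) (E E' : Fin d → ℝ) (t : Fin d → ProbabilityMeasure (Fin d × ℝ))
    (s' s : Fin d) : Measure ℝ :=
  ((sector (t s : Measure (Fin d × ℝ)) s').withDensity
    fun w => boltzmann β (E' s' - E s) w).map fun w => -w

theorem reverseMeasure_apply (t : Fin d → ProbabilityMeasure (Fin d × ℝ)) (s' s : Fin d)
    {S : Set ℝ} (hS : MeasurableSet S) : reverseMeasure β E E' t s' s S =
      ∫⁻ w in (fun w => -w) ⁻¹' S, boltzmann β (E' s' - E s) w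
        ∂(sector (t s : Measure (Fin d × ℝ)) s') := by
  rw [reverseMeasure, Measure.map_apply measurable_neg hS,
    withDensity_apply _ (measurable_neg hS)]

/-- This is where the second law equality makes the candidate limit of the inverse maps a
probability. -/
theorem sum_reverseMeasure_univ {t : Fin d → ProbabilityMeasure (Fin d × ℝ)}
    (ht : SecondLawEquality β E E' t) (s' : Fin d) :
    ∑ s, reverseMeasure β E E' t s' s Set.univ = 1 := by
  rw [← (secondLawEquality_iff β E E' t).1 ht s']
  refine Finset.sum_congr rfl fun s _ => ?_
  rw [reverseMeasure_apply t s' s MeasurableSet.univ, Set.preimage_univ, setLIntegral_univ]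
  rfl

theorem comesFromThermalOperation_of_secondLawEquality (hβ : 0 ≤ β)
    {t : Fin d → ProbabilityMeasure (Fin d × ℝ)} (ht : SecondLawEquality β E E' t) :
    ComesFromThermalOperation β E E' t := by
  obtain ⟨Γ, hΓ⟩ := exists_thermalOperation_seq (E := E) (E' := E') hβ ht
  choose tn htn using fun n => (Γ n).exists_hasWorkMap
  choose rn hrn using fun n => (Γ n).inverse.exists_hasWorkMap
  refine ⟨Γ, tn, rn, fun s' => ⟨assemble (reverseMeasure β E E' t s'),
    isProbabilityMeasure_assemble (sum_reverseMeasure_univ ht s')⟩, htn, hrn,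
    tendsto_pi_nhds.2 fun s => ?_, tendsto_pi_nhds.2 fun s' => ?_⟩
  · refine tendsto_of_forall_isOpen_sector_le_liminf fun s' S hS => ?_
    -- The forward maps correspond to `g = 1`.
    have h := hΓ s s' S 1 hS continuous_const fun δ hδ j j' => by
      simp only [Pi.one_apply, ENNReal.coe_one, mul_one]
      rw [ENNReal.ofReal_le_one, Real.exp_le_one_iff]
      linarith [mul_nonneg hβ (mul_nonneg hδ (Nat.cast_nonneg (α := ℝ) j))]
    simpa [((Γ _).hasWorkMap_iff _).1 (htn _)] using h
  · refine tendsto_of_forall_isOpen_sector_le_liminf fun s S hS => ?_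
    -- The inverse maps correspond to the Boltzmann factor on the reflected set. The bound holds
    -- since exp (-β δ j) exp (β δ (j - j')) = exp (-β δ j') ≤ 1.
    have h := hΓ s s' ((fun w => -w) ⁻¹' S) (boltzmann β (E' s' - E s)) (hS.preimage continuous_neg)
      (continuous_boltzmann _ _) fun δ hδ j j' => by
        rw [coe_boltzmann, ← ENNReal.ofReal_mul (Real.exp_pos _).le, ← Real.exp_add,
          ENNReal.ofReal_le_one, Real.exp_le_one_iff]
        linarith [mul_nonneg hβ (mul_nonneg hδ (Nat.cast_nonneg (α := ℝ) j'))]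
    have hr : ∀ n, sector (rn n s' : Measure (Fin d × ℝ)) s S =
        ∫⁻ w in (fun w => -w) ⁻¹' S, boltzmann β (E' s' - E s) w ∂((Γ n).workMeasure s s') := by
      intro n
      rw [← lintegral_indicator_one hS.measurableSet,
        (htn n).lintegral_sector_inverse (hrn n) s s', ((Γ n).hasWorkMap_iff _).1 (htn n),
        ← lintegral_indicator (measurable_neg hS.measurableSet)]
      refine lintegral_congr fun w => ?_
      by_cases hw : -w ∈ S
      · rw [Set.indicator_of_mem hw, Set.indicator_of_mem (show w ∈ (fun w => -w) ⁻¹' S from hw),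
          Pi.one_apply, mul_one]
      · rw [Set.indicator_of_notMem hw,
          Set.indicator_of_notMem (show w ∉ (fun w => -w) ⁻¹' S from hw), mul_zero]
    simp_rw [hr]
    refine le_trans (le_of_eq ?_) h
    rw [ProbabilityMeasure.coe_mk, sector_assemble, reverseMeasure_apply t s' s hS.measurableSet]

end

end FluctuatingWork

end

theorem mainTheorem4 {d : ℕ} (β : ℝ) (hβ : 0 < β) (E E' : Fin d → ℝ)
    (t : Fin d → ProbabilityMeasure (Fin d × ℝ)) :
    (∀ Γ : FluctuatingWork.ThermalOperation β E E', Γ.HasWorkMap t →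
      FluctuatingWork.SecondLawEquality β E E' t) ∧
    (FluctuatingWork.ComesFromThermalOperation β E E' t ↔
      FluctuatingWork.SecondLawEquality β E E' t) :=
  ⟨fun Γ h => Γ.secondLawEquality_of_hasWorkMap h,
    FluctuatingWork.secondLawEquality_of_comesFromThermalOperation,
    FluctuatingWork.comesFromThermalOperation_of_secondLawEquality hβ.le⟩
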